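/- Let $\mathcal{Q}$ be a finite poset and let $G(\mathcal{Q})$ be a simple complex of finite groups over $\mathcal{Q}$, i.e. a collection of finite groups $P_J$ ($J\in\mathcal{Q}$) together with injective, non-surjective homomorphisms $\varphi_{J,T}:P_J\to P_T$ for all $J<T$, such that $\varphi_{J,V}=\varphi_{T,V}\circ\varphi_{J,T}$ whenever $J<T<V$. Let $G$ be its fundamental group, i.e. the quotient of the free product of the groups $P_J$ by the relations $\varphi_{J,T}(g)=g$ for all $J<T$ and $g\in P_J$. Assume that $G(\mathcal{Q})$ is strictly developable, i.e. that all canonical homomorphisms $P_J\to G$ are injective, and regard each $P_J$ as a subgroup of $G$. Let the development $X$ be the geometric realization of the poset of all pairs $(gP_J,J)$ with $J\in\mathcal{Q}$ and $gP_J\in G/P_J$, where $(gP_J,J)<(g'P_T,T)$ if and only if $J<T$ and $gP_T=g'P_T$; the group $G$ acts on $X$ by left multiplication of cosets. Assume that the fixed point set $X^H$ is contractible for every finite subgroup $H$ of $G$. For $J\in\mathcal{Q}$ let $\Omega_J=\{U\in\mathcal{Q}\mid P_U=P_J \text{ as subgroups of } G\}$, and let $K_{\Omega_J}$ and $K_{>\Omega_J}$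 be the geometric realizations of the subposets $\{V\in\mathcal{Q}\mid U\le V\text{ for some }U\in\Omega_J\}$ and $\{V\in\mathcal{Q}\mid U<V\text{ for some }U\in\Omega_J\}$ of $\mathcal{Q}$. Then $$\underline{\mathrm{cd}}(G)=\max\{\,n\in\mathbb{N}\mid \mathrm{H}^n(K_{\Omega_J},K_{>\Omega_J})\neq 0\text{ for some }J\in\mathcal{Q}\,\},$$ where cohomology has integral coefficients. In particular, $\underline{\mathrm{cd}}(G)$ is finite and the maximum exists. Here the Bredon cohomological dimension $\underline{\mathrm{cd}}(G)$ is the smallest length of a projective resolution of the constant functor $\underline{\mathbb{Z}}$ in the category of contravariant functors from the orbit category of $G$ (objects: the $G$-sets $G/H$ with $H\le G$ finite; morphisms: the $G$-maps) to abelian groups. -/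

import Mathlib

universe u v

/-! ### Bredon cohomological dimension for proper actions -/

/-- The objects `G/H` of the orbit category of `G` with respect to the family of finite subgroups,
recorded by the finite subgroup `H`. -/
structure OrbitCat (G : Type u) [Group G] where
  subgroup : Subgroup G
  finite : Finite subgroup

namespace OrbitCat

variable {G : Type u} [Group G]

/-- Morphisms `G/H ⟶ G/K` are the `G`-equivariant maps of coset spaces. -/
instance : CategoryTheory.SmallCategory (OrbitCat G) where
  Hom H K := (G ⧸ H.subgroup) →[G] (G ⧸ K.subgroup)
  id H := MulActionHom.id G
  comp f g := g.comp f

end OrbitCat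

/-- Right modules over the orbit category: contravariant functors to abelian groups. -/
abbrev OrbitModule (G : Type u) [Group G] : Type (u + 1) :=
  CategoryTheory.Functor (Opposite (OrbitCat G)) (ModuleCat.{u} ℤ)

/-- The trivial module: the constant functor with value `ℤ`. -/
noncomputable def trivialOrbitModule (G : Type u) [Group G] : OrbitModule G :=
  (CategoryTheory.Functor.const _).obj (ModuleCat.of ℤ (ULift.{u} ℤ))

/-- The Bredon cohomological dimension of `G` for the family of finite subgroups: the smallest
length of a projective resolution of the trivial module (`⊤` if there is none of finite length). -/
noncomputable def bredonCd (G : Type u) [Group G] : ℕ∞ :=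
  sInf {d : ℕ∞ | ∃ R : CategoryTheory.ProjectiveResolution (trivialOrbitModule G),
    ∀ i : ℕ, d < (i : ℕ∞) → CategoryTheory.Limits.IsZero (R.complex.X i)}

/-! ### Geometric realization of a poset -/

/-- The points of the geometric realization of (the order complex of) a poset `P`, given by their
barycentric coordinates: finitely supported non-negative weights with sum `1`, whose support is a
chain. -/
structure OrderRealization (P : Type u) [PartialOrder P] where
  weight : P →₀ ℝ
  nonneg : ∀ p, 0 ≤ weight p
  sum_eq_one : (weight.sum fun _ r => r) = 1
  isChain : IsChain (· ≤ ·) (weight.support : Set P)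

namespace OrderRealization

variable {P : Type u} [PartialOrder P]

/-- The closed simplex of the realization spanned by a finite set `s` of vertices (a chain). -/
def closedSimplex (s : Finset P) : Set (OrderRealization P) :=
  {x | x.weight.support ⊆ s}

/-- The Euclidean topology of a closed simplex: the one induced by the (finitely many relevant)
barycentric coordinates. -/
@[reducible]
def simplexTopology (s : Finset P) : TopologicalSpace (closedSimplex s) :=
  TopologicalSpace.induced (fun x => (fun p => x.1.weight p : P → ℝ)) inferInstance

/-- The CW topology: the finest one for which the inclusions of all closed simplices (spanned by
the finite chains) are continuous. -/
instance : TopologicalSpace (OrderRealization P) :=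
  ⨆ s : {s : Finset P // IsChain (· ≤ ·) (s : Set P)},
    TopologicalSpace.coinduced (Subtype.val : closedSimplex s.1 → OrderRealization P)
      (simplexTopology s.1)

@[ext]
theorem ext {x y : OrderRealization P} (h : x.weight = y.weight) : x = y := by
  cases x; cases y; simp_all

/-- The affine extension of an automorphism of the poset to the realization. -/
noncomputable def map (e : P ≃o P) (x : OrderRealization P) : OrderRealization P where
  weight := x.weight.equivMapDomain e.toEquiv
  nonneg p := by simpa using x.nonneg _
  sum_eq_one := by
    rw [Finsupp.sum_equivMapDomain]
    exact x.sum_eq_one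
  isChain := by
    intro a ha b hb hab
    have ha' : e.symm a ∈ (x.weight.support : Set P) := by simpa using ha
    have hb' : e.symm b ∈ (x.weight.support : Set P) := by simpa using hb
    have := x.isChain ha' hb' (fun h => hab (e.symm.injective h))
    simpa using this

end OrderRealization

/-! ### Relative cohomology of the realizations of a pair of subposets -/

section RelativeCohomology

variable {Q : Type u} [PartialOrder Q]

/-- The `n`-simplices of the realization of the subposet `A` of `Q`: chains `s₀ < ⋯ < sₙ` in `A`. -/
def OrderSimplex (A : Set Q) (n : ℕ) : Type u :=
  {s : Fin (n + 1) → Q // StrictMono s ∧ ∀ i, s i ∈ A}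

/-- The `i`-th face, obtained by omitting the `i`-th vertex. -/
def OrderSimplex.face {A : Set Q} {n : ℕ} (s : OrderSimplex A (n + 1)) (i : Fin (n + 2)) :
    OrderSimplex A n :=
  ⟨s.1 ∘ i.succAbove, s.2.1.comp (Fin.strictMono_succAbove i), fun _ => s.2.2 _⟩

/-- The simplicial (that is, cellular) coboundary of the realization of `A`. -/
def simplicialCoboundary (A : Set Q) (n : ℕ) :
    (OrderSimplex A n → ℤ) →ₗ[ℤ] (OrderSimplex A (n + 1) → ℤ) where
  toFun f s := ∑ i : Fin (n + 2), (-1 : ℤ) ^ (i : ℕ) * f (s.face i)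
  map_add' f g := by
    funext s
    simp [mul_add, Finset.sum_add_distrib]
  map_smul' c f := by
    funext s
    simp only [Pi.smul_apply, smul_eq_mul, RingHom.id_apply, Finset.mul_sum]
    exact Finset.sum_congr rfl fun i _ => by ring

theorem simplicialCoboundary_comp (A : Set Q) (n : ℕ) (f : OrderSimplex A n → ℤ) :
    simplicialCoboundary A (n + 1) (simplicialCoboundary A n f) = 0 := by
  funext s
  simp only [simplicialCoboundary, LinearMap.coe_mk, AddHom.coe_mk, Finset.mul_sum, Pi.zero_apply]
  rw [← Finset.sum_product']
  refine Finset.sum_involution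
    (fun ij _ => (ij.1.succAbove ij.2, ij.2.predAbove ij.1)) ?_ ?_ ?_ ?_
  · rintro ⟨i, j⟩ _
    have hface : (s.face (i.succAbove j)).face (j.predAbove i) = (s.face i).face j := by
      apply Subtype.ext
      funext k
      simp only [OrderSimplex.face, Function.comp_apply]
      rw [Fin.succAbove_succAbove_succAbove_predAbove]
    simp only [hface]
    have hsign : (-1 : ℤ) ^ ((i.succAbove j : Fin (n + 3)) : ℕ) *
        (-1 : ℤ) ^ ((j.predAbove i : Fin (n + 2)) : ℕ)
        = -((-1 : ℤ) ^ (i : ℕ) * (-1 : ℤ) ^ (j : ℕ)) := by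
      rcases lt_or_ge (j.castSucc) i with h | h
      · rw [Fin.succAbove_of_castSucc_lt _ _ h, Fin.predAbove_of_castSucc_lt _ _ h]
        have hi : (i : ℕ) = ((i.pred (Fin.ne_zero_of_lt h) : Fin (n + 2)) : ℕ) + 1 := by
          have := Fin.ne_zero_of_lt h
          rw [Fin.val_pred]
          have : (i : ℕ) ≠ 0 := fun h0 => this (Fin.ext h0)
          omega
        rw [hi, Fin.val_castSucc]
        ring
      · rw [Fin.succAbove_of_le_castSucc _ _ h, Fin.predAbove_of_le_castSucc _ _ h]
        simp only [Fin.val_succ, Fin.coe_castPred]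
        ring
    linear_combination f ((s.face i).face j) * hsign
  · rintro ⟨i, j⟩ _ _ h
    exact Fin.succAbove_ne i j (congrArg Prod.fst h)
  · rintro ⟨i, j⟩ _
    exact Finset.mem_univ _
  · rintro ⟨i, j⟩ _
    exact Prod.ext (Fin.succAbove_succAbove_predAbove i j) (Fin.predAbove_predAbove_succAbove i j)

/-- The relative `n`-cochains of the pair `(|A|, |B|)`: integral cochains on `|A|` that vanish on
the simplices of `|B|`. -/
def relCochains (A B : Set Q) (n : ℕ) : Submodule ℤ (OrderSimplex A n → ℤ) where
  carrier := {f | ∀ s : OrderSimplex A n, (∀ i, s.1 i ∈ B) → f s = 0}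
  add_mem' hf hg s hs := by simp [hf s hs, hg s hs]
  zero_mem' _ _ := rfl
  smul_mem' c f hf s hs := by simp [hf s hs]

theorem simplicialCoboundary_mem (A B : Set Q) (n : ℕ) (f : OrderSimplex A n → ℤ)
    (hf : f ∈ relCochains A B n) : simplicialCoboundary A n f ∈ relCochains A B (n + 1) :=
  fun s hs => by
    change ∑ i : Fin (n + 2), (-1 : ℤ) ^ (i : ℕ) * f (s.face i) = 0
    refine Finset.sum_eq_zero fun i _ => ?_
    rw [hf (s.face i) fun _ => hs _, mul_zero]

/-- The cochain complex of the pair `(|A|, |B|)`. -/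
noncomputable def relCochainComplex (A B : Set Q) : CochainComplex (ModuleCat.{u} ℤ) ℕ :=
  CochainComplex.of (fun n => ModuleCat.of ℤ (relCochains A B n))
    (fun n => ModuleCat.ofHom
      ((simplicialCoboundary A n).restrict (simplicialCoboundary_mem A B n)))
    (fun n => by
      refine ModuleCat.hom_ext (LinearMap.ext fun f => ?_)
      exact Subtype.ext (simplicialCoboundary_comp A n f.1))

/-- The relative cohomology `Hⁿ(|A|, |B|)` with integral coefficients. -/
noncomputable def relCohomology (A B : Set Q) (n : ℕ) : ModuleCat.{u} ℤ :=
  (relCochainComplex A B).homology n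

/-- The subposet of elements above some element of `Ω`. -/
def upperSubposet (Ω : Set Q) : Set Q := {V | ∃ U ∈ Ω, U ≤ V}

/-- The subposet of elements strictly above some element of `Ω`. -/
def strictUpperSubposet (Ω : Set Q) : Set Q := {V | ∃ U ∈ Ω, U < V}

end RelativeCohomology

/-! ### Simple complexes of finite groups -/

/-- A simple complex of finite groups over a poset `Q`: finite groups `P J`, and for `J < T` an
injective, non-surjective homomorphism `P J → P T`, compatibly with composition. -/
structure SimpleComplexOfFiniteGroups (Q : Type u) [PartialOrder Q] where
  P : Q → Type v
  [group : ∀ J, Group (P J)]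
  [finite : ∀ J, Finite (P J)]
  φ : ∀ {J T : Q}, J < T → (P J →* P T)
  injective : ∀ {J T : Q} (h : J < T), Function.Injective (φ h)
  not_surjective : ∀ {J T : Q} (h : J < T), ¬ Function.Surjective (φ h)
  comp : ∀ {J T V : Q} (h : J < T) (h' : T < V), φ (h.trans h') = (φ h').comp (φ h)

namespace SimpleComplexOfFiniteGroups

attribute [instance] SimpleComplexOfFiniteGroups.group SimpleComplexOfFiniteGroups.finite

variable {Q : Type u} [PartialOrder Q] (𝒢 : SimpleComplexOfFiniteGroups.{u, v} Q)

/-- The relators `φ(g) g⁻¹`, for `J < T` and `g` in the local group at `J`, in the free product of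
the local groups. -/
def relators : Set (Monoid.CoprodI 𝒢.P) :=
  {r | ∃ (J T : Q) (h : J < T) (g : 𝒢.P J),
    r = Monoid.CoprodI.of (𝒢.φ h g) * (Monoid.CoprodI.of g)⁻¹}

/-- The fundamental group (direct limit): the free product of the local groups modulo the
relations `φ(g) = g`. -/
abbrev FundamentalGroup : Type (max u v) :=
  Monoid.CoprodI 𝒢.P ⧸ Subgroup.normalClosure 𝒢.relators

/-- The canonical homomorphism from a local group to the fundamental group. -/
def ι (J : Q) : 𝒢.P J →* 𝒢.FundamentalGroup :=
  (QuotientGroup.mk' _).comp Monoid.CoprodI.of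

/-- Strict developability: all canonical homomorphisms are injective. -/
def StrictlyDevelopable : Prop := ∀ J, Function.Injective (𝒢.ι J)

/-- The local group at `J`, as a subgroup of the fundamental group. -/
def localSubgroup (J : Q) : Subgroup 𝒢.FundamentalGroup := (𝒢.ι J).range

theorem ι_φ {J T : Q} (h : J < T) (g : 𝒢.P J) : 𝒢.ι T (𝒢.φ h g) = 𝒢.ι J g := by
  rw [← mul_inv_eq_one, ← map_inv]
  refine (QuotientGroup.eq_one_iff _).2 (Subgroup.subset_normalClosure ?_)
  exact ⟨J, T, h, g, by rw [← map_inv]⟩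

theorem localSubgroup_mono {J T : Q} (h : J ≤ T) : 𝒢.localSubgroup J ≤ 𝒢.localSubgroup T := by
  rcases h.eq_or_lt with rfl | h
  · exact le_rfl
  · rintro _ ⟨g, rfl⟩
    exact ⟨𝒢.φ h g, 𝒢.ι_φ h g⟩

/-- The set of pairs `(gP_J, J)`. -/
structure DevelopmentPoset where
  index : Q
  coset : 𝒢.FundamentalGroup ⧸ 𝒢.localSubgroup index

namespace DevelopmentPoset

/-- `(gP_J, J) ≤ (g'P_T, T)` if and only if `J ≤ T` and `gP_T = g'P_T`. -/
instance : PartialOrder 𝒢.DevelopmentPoset where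
  le x y := x.index ≤ y.index ∧
    ∃ g : 𝒢.FundamentalGroup, x.coset = QuotientGroup.mk g ∧ y.coset = QuotientGroup.mk g
  le_refl x := ⟨le_rfl, by
    obtain ⟨g, hg⟩ := QuotientGroup.mk_surjective x.coset
    exact ⟨g, hg.symm, hg.symm⟩⟩
  le_trans x y z := by
    rintro ⟨hxy, g, hx, hy⟩ ⟨hyz, g', hy', hz⟩
    refine ⟨hxy.trans hyz, g, hx, hz.trans ?_⟩
    rw [hy, QuotientGroup.eq] at hy'
    exact (QuotientGroup.eq.2 (𝒢.localSubgroup_mono hyz hy')).symm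
  le_antisymm x y := by
    obtain ⟨J, a⟩ := x
    obtain ⟨T, b⟩ := y
    rintro ⟨hxy, g, hx, hy⟩ ⟨hyx, -⟩
    obtain rfl : J = T := le_antisymm hxy hyx
    rw [DevelopmentPoset.mk.injEq]
    exact ⟨rfl, heq_of_eq (hx.trans hy.symm)⟩

theorem mk_lt_mk_iff {J T : Q} (g g' : 𝒢.FundamentalGroup) :
    (⟨J, QuotientGroup.mk g⟩ : 𝒢.DevelopmentPoset) < ⟨T, QuotientGroup.mk g'⟩ ↔
      J < T ∧ (QuotientGroup.mk g : 𝒢.FundamentalGroup ⧸ 𝒢.localSubgroup T)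
        = QuotientGroup.mk g' := by
  constructor
  · intro h
    obtain ⟨hJT, k, hk, hk'⟩ := h.le
    have hJT' : J ≤ T := hJT
    have hne : J ≠ T := by
      rintro rfl
      apply h.ne
      rw [DevelopmentPoset.mk.injEq]
      exact ⟨rfl, heq_of_eq (hk.trans hk'.symm)⟩
    refine ⟨lt_of_le_of_ne hJT' hne, ?_⟩
    refine Eq.trans ?_ hk'.symm
    exact QuotientGroup.eq.2 (𝒢.localSubgroup_mono hJT' (QuotientGroup.eq.1 hk))
  · rintro ⟨h, hg⟩
    refine lt_of_le_of_ne ⟨h.le, g, rfl, hg.symm⟩ fun he => ?_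
    exact h.ne (congrArg DevelopmentPoset.index he)

/-- The action of the fundamental group: `h • (gP_J, J) = (hgP_J, J)`. -/
instance : MulAction 𝒢.FundamentalGroup 𝒢.DevelopmentPoset where
  smul h x := ⟨x.index, h • x.coset⟩
  one_smul x := by
    change (⟨x.index, (1 : 𝒢.FundamentalGroup) • x.coset⟩ : 𝒢.DevelopmentPoset) = x
    rw [one_smul]
  mul_smul h k x := by
    change (⟨x.index, (h * k) • x.coset⟩ : 𝒢.DevelopmentPoset) = ⟨x.index, h • k • x.coset⟩
    rw [mul_smul]

theorem smul_le_smul_of_le (h : 𝒢.FundamentalGroup) {x y : 𝒢.DevelopmentPoset} (hxy : x ≤ y) :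
    h • x ≤ h • y := by
  obtain ⟨hle, g, hx, hy⟩ := hxy
  refine ⟨hle, h * g, ?_, ?_⟩
  · change h • x.coset = _
    rw [hx]
    rfl
  · change h • y.coset = _
    rw [hy]
    rfl

/-- The action of an element of the fundamental group as an automorphism of the poset. -/
def smulOrderIso (h : 𝒢.FundamentalGroup) : 𝒢.DevelopmentPoset ≃o 𝒢.DevelopmentPoset where
  toEquiv := MulAction.toPerm h
  map_rel_iff' {x y} := by
    refine ⟨fun hxy => ?_, fun hxy => smul_le_smul_of_le 𝒢 h hxy⟩
    simpa using smul_le_smul_of_le 𝒢 h⁻¹ hxy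

end DevelopmentPoset

/-- The development: the geometric realization of the poset of pairs `(gP_J, J)`. -/
abbrev Development : Type (max u v) := OrderRealization 𝒢.DevelopmentPoset

/-- The simplicial action of the fundamental group on the development. -/
noncomputable instance : MulAction 𝒢.FundamentalGroup 𝒢.Development where
  smul h x := x.map (DevelopmentPoset.smulOrderIso 𝒢 h)
  one_smul x := by
    apply OrderRealization.ext
    refine Finsupp.ext fun p => ?_
    change x.weight ((1 : 𝒢.FundamentalGroup)⁻¹ • p) = x.weight p
    rw [inv_one, one_smul]
  mul_smul h k x := by
    apply OrderRealization.ext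
    refine Finsupp.ext fun p => ?_
    change x.weight ((h * k)⁻¹ • p) = x.weight (k⁻¹ • h⁻¹ • p)
    rw [mul_inv_rev, mul_smul]

/-- The set `Ω_J` of all `U` whose local group coincides with the one at `J` as a subgroup of the
fundamental group. -/
def sameLocalGroup (J : Q) : Set Q := {U | 𝒢.localSubgroup U = 𝒢.localSubgroup J}

end SimpleComplexOfFiniteGroups

/-! Let `C_n` be the free module over the orbit category with one generator at `G/P_{J₀}` for each
chain `J₀ < ⋯ < Jₙ` in `Q`. A basis element of `C_n(G/H)` is such a chain together with a `G`-map
`G/H → G/P_{J₀}`, that is, an `H`-fixed coset of `P_{J₀}`; this is the same as an `n`-simplex of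
`X^H`. So `C(G/H)` is the simplicial chain complex of `X^H`, and contractibility of all `X^H` makes
`C` a projective resolution of the trivial module (`isProjectiveResolution_augmentation`). A cochain
in `Hom(C_n, M)` is a family of elements of `M(G/P_{J₀})` indexed by the chains
(`cocyclesBound_iff`), so everything reduces to a coefficient system on the finite poset `Q`.

Developability and non-surjectivity make the order of `P_J` strictly increasing in `J`, so `Ω_J` is
an antichain. The simplices of `K_{Ω_J}` outside `K_{>Ω_J}` are therefore the chains with initial
vertex in `Ω_J`, and the relative cochain complex is the product over `U ∈ Ω_J` of the cochains on
chains starting at `U`.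

Upper bound: let `d` be the largest degree with nonzero relative cohomology. The integral cochains
on chains starting at `U` are exact above degree `d` (`starExact_of_relCohomology`). A bounded
complex of finitely generated free groups that is exact from some degree on is contractible there,
so exactness persists with any coefficients (`StarExact.exact`). Filtering by the initial vertex
gives vanishing of the cohomology of `Hom(C, M)` above `d` for every `M` (`exists_coboundary_eq`),
and dimension shifting turns this into a resolution of length `d` (`exists_length_le`).

Lower bound: take for `M` the module that is `ℤ` on subgroups of order `|P_J|` and `0` elsewhere.
Comparable vertices with local groups of equal order coincide, so `Hom(C, M)` splits over the
vertices of that order, and those in `Ω_J` contribute the relative cochains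
(`not_nontrivial_relCohomology_of_cocyclesBound`). A resolution shorter than `d` would kill this
cohomology in degree `d`, by comparison of resolutions.

Acyclicity of the simplicial chains of a contractible realization is proved directly
(`exists_bdry_eq_of_contractible`). A cycle is subdivided into lists of nearby points, the
contraction is sampled at finitely many times, and each point is sent to a vertex of largest
barycentric coordinate. Nearby points go to vertices of a common simplex, so successive times differ
by prisms, and the last map is constant. -/

/-- A linear map sends the span of a family of basis vectors into a submodule as soon as it does so
for each of these vectors. -/
theorem Finsupp.map_mem_of_mem_supported {α M : Type*} [AddCommGroup M] {p : Set α}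
    {S : Submodule ℤ M} (L : (α →₀ ℤ) →ₗ[ℤ] M) (h : ∀ t ∈ p, L (Finsupp.single t 1) ∈ S)
    {x : α →₀ ℤ} (hx : x ∈ Finsupp.supported ℤ ℤ p) : L x ∈ S := by
  have : Finsupp.supported ℤ ℤ p ≤ S.comap L := by
    rw [Finsupp.supported_eq_span_single, Submodule.span_le]
    rintro _ ⟨t, ht, rfl⟩
    exact h t ht
  exact this hx

/-! ### The augmented complex of lists -/

namespace ListChain

open Finsupp

variable {α β : Type*}

/-- Prepending `a` to every list: the cone operator of the complex of lists. -/
noncomputable def cone (a : α) : (List α →₀ ℤ) →ₗ[ℤ] (List α →₀ ℤ) :=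
  lmapDomain ℤ ℤ (List.cons a)

@[simp]
theorem cone_single (a : α) (t : List α) (c : ℤ) :
    cone a (single t c) = single (a :: t) c := by
  simp [cone]

/-- The boundary of a list, considered as an ordered simplex of the augmented complex. -/
noncomputable def bdryList : List α → (List α →₀ ℤ)
  | [] => 0
  | a :: t => single t 1 - cone a (bdryList t)

/-- The boundary operator of the augmented complex of lists. -/
noncomputable def bdry : (List α →₀ ℤ) →ₗ[ℤ] (List α →₀ ℤ) :=
  lsum ℤ fun t => LinearMap.toSpanSingleton ℤ _ (bdryList t)

@[simp]
theorem bdry_nil (c : ℤ) : bdry (single ([] : List α) c) = 0 := by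
  simp [bdry, bdryList]

theorem bdry_cons (a : α) (t : List α) :
    bdry (single (a :: t) 1) = single t 1 - cone a (bdry (single t 1)) := by
  simp [bdry, bdryList]

/-- The empty list is the simplex of degree `-1`, so this holds in all degrees without an
augmentation term: coning is a contraction of the augmented complex. -/
theorem bdry_cone (a : α) (x : List α →₀ ℤ) : bdry (cone a x) = x - cone a (bdry x) := by
  have : bdry ∘ₗ cone a = LinearMap.id - cone a ∘ₗ bdry := by
    ext t : 2
    simp [bdry_cons]
  exact LinearMap.congr_fun this x

/-- The chain map of list complexes induced by a map of vertices. -/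
noncomputable def push (f : α → β) : (List α →₀ ℤ) →ₗ[ℤ] (List β →₀ ℤ) :=
  lmapDomain ℤ ℤ (List.map f)

@[simp]
theorem push_single (f : α → β) (t : List α) (c : ℤ) :
    push f (single t c) = single (t.map f) c := by
  simp [push]

theorem push_cone (f : α → β) (a : α) (x : List α →₀ ℤ) :
    push f (cone a x) = cone (f a) (push f x) := by
  have : push f ∘ₗ cone a = cone (f a) ∘ₗ push f := by
    ext t : 2
    simp
  exact LinearMap.congr_fun this x

theorem bdry_push (f : α → β) (x : List α →₀ ℤ) : bdry (push f x) = push f (bdry x) := by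
  have : bdry ∘ₗ push f = push f ∘ₗ bdry := by
    ext t : 2
    induction t with
    | nil => simp
    | cons a t ih =>
      simp only [LinearMap.comp_apply, lsingle_apply, push_single, List.map_cons] at ih ⊢
      rw [bdry_cons, bdry_cons, ih, map_sub, push_cone, push_single]
  exact LinearMap.congr_fun this x

/-- The prism over a list, with bottom the image under `f` and top the image under `g`. -/
noncomputable def prismList (f g : α → β) : List α → (List β →₀ ℤ)
  | [] => 0
  | a :: t => single (f a :: g a :: t.map g) 1 - cone (f a) (prismList f g t)

/-- The prism operator: a chain homotopy between the maps induced by two maps of vertices. -/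
noncomputable def prism (f g : α → β) : (List α →₀ ℤ) →ₗ[ℤ] (List β →₀ ℤ) :=
  lsum ℤ fun t => LinearMap.toSpanSingleton ℤ _ (prismList f g t)

theorem prism_single (f g : α → β) (t : List α) : prism f g (single t 1) = prismList f g t := by
  simp [prism]

theorem prism_cone (f g : α → β) (a : α) (x : List α →₀ ℤ) :
    prism f g (cone a x) = cone (f a) (cone (g a) (push g x)) - cone (f a) (prism f g x) := by
  have : prism f g ∘ₗ cone a =
      cone (f a) ∘ₗ cone (g a) ∘ₗ push g - cone (f a) ∘ₗ prism f g := by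
    ext t : 2
    simp [prism_single, prismList]
  exact LinearMap.congr_fun this x

theorem bdry_prism (f g : α → β) (x : List α →₀ ℤ) :
    bdry (prism f g x) = push g x - push f x - prism f g (bdry x) := by
  have : bdry ∘ₗ prism f g = push g - push f - prism f g ∘ₗ bdry := by
    ext t : 2
    induction t with
    | nil => simp [prism_single, prismList]
    | cons a t ih =>
      simp only [LinearMap.comp_apply, lsingle_apply, LinearMap.sub_apply] at ih ⊢
      rw [← cone_single, prism_cone, map_sub, bdry_cone, bdry_cone, bdry_cone, bdry_cone, ih,
        bdry_push, map_sub (prism f g), prism_cone, push_cone, push_cone]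
      simp only [map_sub]
      abel
  exact LinearMap.congr_fun this x

theorem cone_mem_supported {p q : Set (List α)} {a : α} (h : ∀ t ∈ p, a :: t ∈ q)
    {x : List α →₀ ℤ} (hx : x ∈ supported ℤ ℤ p) : cone a x ∈ supported ℤ ℤ q :=
  map_mem_of_mem_supported _
    (fun t ht => by simpa using single_mem_supported (M := ℤ) ℤ 1 (h t ht)) hx

theorem push_mem_supported {p : Set (List α)} {q : Set (List β)} {f : α → β}
    (h : ∀ t ∈ p, t.map f ∈ q) {x : List α →₀ ℤ} (hx : x ∈ supported ℤ ℤ p) :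
    push f x ∈ supported ℤ ℤ q :=
  map_mem_of_mem_supported _
    (fun t ht => by simpa using single_mem_supported (M := ℤ) ℤ 1 (h t ht)) hx

/-- Every list in the prism over `t` has all its members among the images of members of `t` under
`f` and `g`; the hypothesis asks only for this, and so ignores order and repetitions. -/
theorem prism_mem_supported {p : Set (List α)} {q : Set (List β)} {f g : α → β}
    (h : ∀ t ∈ p, ∀ s : List β, (∀ b ∈ s, ∃ a ∈ t, b = f a ∨ b = g a) → s ∈ q)
    {x : List α →₀ ℤ} (hx : x ∈ supported ℤ ℤ p) :
    prism f g x ∈ supported ℤ ℤ q := by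
  have key : ∀ t : List α, prism f g (single t 1) ∈
      supported ℤ ℤ {s : List β | ∀ b ∈ s, ∃ a ∈ t, b = f a ∨ b = g a} := by
    intro t
    induction t with
    | nil => simp [prism_single, prismList]
    | cons a t ih =>
      rw [prism_single, prismList, ← prism_single]
      refine Submodule.sub_mem _ (single_mem_supported ℤ 1 ?_) (cone_mem_supported ?_ ih)
      · intro b hb
        simp only [List.mem_cons, List.mem_map] at hb ⊢
        rcases hb with rfl | rfl | ⟨c, hc, rfl⟩
        · exact ⟨a, by simp⟩
        · exact ⟨a, by simp⟩
        · exact ⟨c, by simp [hc]⟩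
      · intro s hs b hb
        simp only [List.mem_cons] at hb ⊢
        rcases hb with rfl | hb
        · exact ⟨a, by simp⟩
        · obtain ⟨c, hc, h⟩ := hs b hb
          exact ⟨c, by simp [hc], h⟩
  exact map_mem_of_mem_supported _ (fun t ht => supported_mono (fun s hs => h t ht s hs) (key t)) hx

end ListChain

/-! ### Acyclicity of lists of nearby points in a convex set -/

namespace ListChain

open Finsupp

variable {α β : Type*}

/-- A cycle whose image can be moved to a point through finitely many prisms inside `q` bounds
inside `q`. -/
theorem exists_bdry_eq_push {p : Set (List α)} {q : Set (List β)} (f : ℕ → α → β) (N : ℕ) (c : β)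
    (hN : ∀ a, f N a = c)
    (h : ∀ k < N, ∀ t ∈ p, ∀ s : List β, (∀ b ∈ s, ∃ a ∈ t, b = f k a ∨ b = f (k + 1) a) → s ∈ q)
    (hc : ∀ s : List β, (∀ b ∈ s, b = c) → s ∈ q)
    {z : List α →₀ ℤ} (hz : z ∈ supported ℤ ℤ p) (hz0 : bdry z = 0) :
    ∃ w ∈ supported ℤ ℤ q, bdry w = push (f 0) z := by
  have step : ∀ k ≤ N, ∃ w ∈ supported ℤ ℤ q, bdry w = push (f k) z - push (f 0) z := by
    intro k
    induction k with
    | zero => exact fun _ => ⟨0, Submodule.zero_mem _, by simp⟩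
    | succ k ih =>
      intro hk
      obtain ⟨w, hw, hw'⟩ := ih (by omega)
      refine ⟨w + prism (f k) (f (k + 1)) z,
        Submodule.add_mem _ hw (prism_mem_supported (h k (by omega)) hz), ?_⟩
      rw [map_add, hw', bdry_prism, hz0]
      simp
  obtain ⟨w, hw, hw'⟩ := step N le_rfl
  -- At time `N` the cycle is supported on lists with the single member `c`, where the cone from `c`
  -- fills it.
  refine ⟨cone c (push (f N) z) - w, Submodule.sub_mem _ ?_ hw, ?_⟩
  · have : push (f N) z ∈ supported ℤ ℤ {s : List β | ∀ b ∈ s, b = c} := by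
      refine push_mem_supported (p := p) ?_ hz
      intro t _ b hb
      obtain ⟨a, _, rfl⟩ := List.mem_map.1 hb
      exact hN a
    refine cone_mem_supported (fun t ht => hc _ ?_) this
    intro b hb
    rcases List.mem_cons.1 hb with rfl | hb
    · rfl
    · exact ht b hb
  · rw [map_sub, bdry_cone, hw', bdry_push, hz0]
    simp

/-- The lists of points of `C` with pairwise distances less than `ε`. -/
def smallLists {E : Type*} [PseudoMetricSpace E] (C : Set E) (ε : ℝ) : Set (List E) :=
  {l | (∀ x ∈ l, x ∈ C) ∧ ∀ x ∈ l, ∀ y ∈ l, dist x y < ε}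

theorem smallLists_mono {E : Type*} [PseudoMetricSpace E] {C C' : Set E} (h : C ⊆ C') (ε : ℝ) :
    smallLists C ε ⊆ smallLists C' ε :=
  fun _ hl => ⟨fun x hx => h (hl.1 x hx), hl.2⟩

/-- A chain involves only finitely many distances, so their strict bound `ε` can be lowered. The gap
leaves room to move the points while keeping the lists small. -/
theorem exists_slack {E : Type*} [PseudoMetricSpace E] {C : Set E} {ε : ℝ} (hε : 0 < ε)
    {z : List E →₀ ℤ} (hz : z ∈ supported ℤ ℤ (smallLists C ε)) :
    ∃ δ, 0 ≤ δ ∧ δ < ε ∧ ∀ l ∈ z.support, ∀ x ∈ l, ∀ y ∈ l, dist x y ≤ δ := by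
  classical
  let T : Finset ℝ := insert 0 (z.support.biUnion fun l =>
    (l.toFinset ×ˢ l.toFinset).image fun xy => dist xy.1 xy.2)
  have hT : T.Nonempty := ⟨0, Finset.mem_insert_self _ _⟩
  refine ⟨T.max' hT, T.le_max' _ (Finset.mem_insert_self _ _), ?_, ?_⟩
  · rw [Finset.max'_lt_iff]
    intro r hr
    simp only [T, Finset.mem_insert, Finset.mem_biUnion, Finset.mem_image, Finset.mem_product,
      List.mem_toFinset] at hr
    rcases hr with rfl | ⟨l, hl, ⟨x, y⟩, ⟨hx, hy⟩, rfl⟩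
    · exact hε
    · exact (hz hl).2 x hx y hy
  · intro l hl x hx y hy
    refine T.le_max' _ ?_
    simp only [T, Finset.mem_insert, Finset.mem_biUnion, Finset.mem_image, Finset.mem_product,
      List.mem_toFinset]
    exact Or.inr ⟨l, hl, (x, y), ⟨hx, hy⟩, rfl⟩

/-- The complex of small lists in a bounded convex set is acyclic. -/
theorem exists_bdry_eq_of_convex {E : Type*} [NormedAddCommGroup E] [NormedSpace ℝ E] {C : Set E}
    (hC : Convex ℝ C) {c : E} (hc : c ∈ C) {D : ℝ} (hD : ∀ x ∈ C, dist x c ≤ D)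
    {ε : ℝ} (hε : 0 < ε) {z : List E →₀ ℤ} (hz : z ∈ supported ℤ ℤ (smallLists C ε))
    (hz0 : bdry z = 0) : ∃ w ∈ supported ℤ ℤ (smallLists C ε), bdry w = z := by
  obtain ⟨δ, hδ0, hδ, hδz⟩ := exists_slack hε hz
  have hD0 : 0 ≤ D := dist_nonneg.trans (hD c hc)
  -- The straight-line contraction to `c` in `N` equal steps moves each point by at most `D / N` per
  -- step; this choice gives `D / N + δ < ε`, so every prism consists of small lists.
  obtain ⟨N, hN⟩ := exists_nat_gt (D / (ε - δ))
  have hN0 : (0 : ℝ) < N := lt_of_le_of_lt (div_nonneg hD0 (by linarith)) hN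
  have hDN : D / N + δ < ε := by
    rw [div_lt_iff₀ (by linarith)] at hN
    have : D / N < ε - δ := by
      rw [div_lt_iff₀ hN0]
      linarith
    linarith
  let f : ℕ → E → E := fun k x => c + (1 - k / N : ℝ) • (x - c)
  have hf0 : f 0 = id := by
    funext x
    simp [f]
  have hfC : ∀ k ≤ N, ∀ x ∈ C, f k x ∈ C := by
    intro k hk x hx
    have h1 : (k : ℝ) / N ≤ 1 := by
      rw [div_le_one hN0]
      exact_mod_cast hk
    have h0 : 0 ≤ (k : ℝ) / N := by positivity
    have := hC hc hx h0 (sub_nonneg.2 h1) (by ring)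
    convert this using 1
    simp only [f, smul_sub, sub_smul, one_smul]
    abel
  have hdist : ∀ k ≤ N, ∀ x y, dist (f k x) (f k y) ≤ dist x y := by
    intro k hk x y
    have h1 : (k : ℝ) / N ≤ 1 := by
      rw [div_le_one hN0]
      exact_mod_cast hk
    have h0 : 0 ≤ (k : ℝ) / N := by positivity
    simp only [f, dist_add_left]
    rw [dist_smul₀, dist_sub_right, Real.norm_of_nonneg (by linarith)]
    exact mul_le_of_le_one_left dist_nonneg (by linarith)
  have hstep : ∀ k, ∀ x ∈ C, dist (f k x) (f (k + 1) x) ≤ D / N := by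
    intro k x hx
    simp only [f, dist_add_left]
    rw [dist_eq_norm, ← sub_smul, norm_smul]
    have : (1 - (k : ℝ) / N) - (1 - ((k + 1 : ℕ) : ℝ) / N) = 1 / N := by
      push_cast
      ring
    rw [this, Real.norm_of_nonneg (by positivity), ← dist_eq_norm, div_mul_eq_mul_div, one_mul]
    exact div_le_div_of_nonneg_right (hD x hx) hN0.le
  have hz' : z ∈ supported ℤ ℤ {l : List E | (∀ x ∈ l, x ∈ C) ∧ ∀ x ∈ l, ∀ y ∈ l, dist x y ≤ δ} :=
    fun l hl => ⟨(hz hl).1, hδz l hl⟩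
  have := exists_bdry_eq_push (q := smallLists C ε) f N c ?_ ?_ ?_ hz' hz0
  · obtain ⟨w, hw, hw'⟩ := this
    refine ⟨w, hw, hw'.trans ?_⟩
    rw [hf0]
    simp [push]
  · intro a
    simp [f, div_self hN0.ne']
  · rintro k hk t ⟨htC, htδ⟩ s hs
    constructor
    · intro b hb
      obtain ⟨a, ha, rfl | rfl⟩ := hs b hb
      · exact hfC k hk.le a (htC a ha)
      · exact hfC (k + 1) hk a (htC a ha)
    · intro b hb b' hb'
      obtain ⟨a, ha, hab⟩ := hs b hb
      obtain ⟨a', ha', hab'⟩ := hs b' hb'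
      have h1 := htδ a ha a' ha'
      have h2 := hstep k a (htC a ha)
      have h3 := hstep k a' (htC a' ha')
      have h4 := hdist k hk.le a a'
      have h5 := hdist (k + 1) hk a a'
      have h6 : 0 ≤ D / N := by positivity
      rcases hab with rfl | rfl <;> rcases hab' with rfl | rfl
      · linarith
      · linarith [dist_triangle (f k a) (f k a') (f (k + 1) a')]
      · rw [dist_comm] at h2
        rw [dist_comm] at h2 ⊢
        have := dist_triangle (f k a') (f k a) (f (k + 1) a)
        rw [dist_comm (f k a') (f k a)] at this
        linarith
      · linarith
  · intro s hs
    refine ⟨fun x hx => hs x hx ▸ hc, fun x hx y hy => ?_⟩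
    rw [hs x hx, hs y hy, dist_self]
    exact hε

end ListChain

/-! ### The augmented complex of finite subsets of a poset -/

namespace FinsetChain

open Finsupp

open scoped Classical in
/-- The sign with which `a` is inserted into (or removed from) `s`. -/
noncomputable def sgn {P : Type*} [PartialOrder P] (a : P) (s : Finset P) : ℤ :=
  (-1) ^ (s.filter (· < a)).card

variable {P : Type*} [PartialOrder P]

theorem sgn_mul_self (a : P) (s : Finset P) : sgn a s * sgn a s = 1 := by
  rw [sgn, ← mul_pow]
  simp

open scoped Classical in
theorem sgn_erase (a b : P) (s : Finset P) (hb : b ∈ s) :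
    sgn a (s.erase b) = if b < a then - sgn a s else sgn a s := by
  rw [sgn, sgn, Finset.filter_erase]
  split_ifs with h
  · have hm : b ∈ s.filter (· < a) := by simp [hb, h]
    rw [← Finset.card_erase_add_one hm]
    ring
  · rw [Finset.erase_eq_of_notMem]
    simp [h]

open scoped Classical in
theorem sgn_insert (a b : P) (s : Finset P) (hb : b ∉ s) :
    sgn a (insert b s) = if b < a then - sgn a s else sgn a s := by
  have := sgn_erase a b (insert b s) (Finset.mem_insert_self _ _)
  rw [Finset.erase_insert hb] at this
  rw [this]
  split_ifs <;> simp

open scoped Classical in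
/-- The boundary operator of the augmented complex of finite subsets. -/
noncomputable def bdry : (Finset P →₀ ℤ) →ₗ[ℤ] (Finset P →₀ ℤ) :=
  lsum ℤ fun s => LinearMap.toSpanSingleton ℤ _ (∑ a ∈ s, sgn a s • single (s.erase a) 1)

open scoped Classical in
/-- The insertion of a vertex: the cone operator of the complex of finite subsets. -/
noncomputable def ins (a : P) : (Finset P →₀ ℤ) →ₗ[ℤ] (Finset P →₀ ℤ) :=
  lsum ℤ fun s => LinearMap.toSpanSingleton ℤ _
    (if a ∈ s then 0 else sgn a s • single (insert a s) 1)

open scoped Classical in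
theorem bdry_single (s : Finset P) :
    bdry (single s 1) = ∑ a ∈ s, sgn a s • single (s.erase a) 1 := by
  simp [bdry]

open scoped Classical in
theorem ins_single (a : P) (s : Finset P) :
    ins a (single s 1) = if a ∈ s then 0 else sgn a s • single (insert a s) 1 := by
  simp [ins]

-- If `a` and `b` are distinct and comparable, exactly one of `a < b`, `b < a` holds, so exactly one
-- of the two signs flips and the mixed terms cancel. This is why comparability is required.
open scoped Classical in
theorem bdry_ins_single (a : P) (s : Finset P) (h : ∀ b ∈ s, a ≤ b ∨ b ≤ a) :
    bdry (ins a (single s 1)) = single s 1 - ins a (bdry (single s 1)) := by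
  rw [eq_sub_iff_add_eq, ins_single, bdry_single, map_sum]
  simp only [map_smul, ins_single]
  by_cases ha : a ∈ s
  · rw [if_pos ha, map_zero, zero_add, Finset.sum_eq_single_of_mem a ha]
    · have : sgn a (s.erase a) = sgn a s := by simp [sgn_erase a a s ha]
      simp [Finset.insert_erase ha, this, sgn_mul_self]
    · intro b _ hba
      rw [if_pos (Finset.mem_erase.2 ⟨hba.symm, ha⟩), smul_zero]
  · rw [if_neg ha, map_smul, bdry_single, Finset.sum_insert ha, Finset.erase_insert ha, smul_add,
      smul_smul, add_assoc, Finset.smul_sum, ← Finset.sum_add_distrib]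
    have h1 : sgn a (insert a s) = sgn a s := by simp [sgn_insert a a s ha]
    rw [h1, sgn_mul_self, one_smul, Finset.sum_eq_zero, add_zero]
    intro b hb
    have hab : a ≠ b := fun h => ha (h ▸ hb)
    rw [if_neg (fun h => ha (Finset.mem_of_mem_erase h)), smul_smul, smul_smul,
      Finset.erase_insert_of_ne hab, ← add_smul, sgn_insert b a s ha, sgn_erase a b s hb]
    convert zero_smul ℤ _
    rcases h b hb with h | h
    · have h1 := lt_of_le_of_ne h hab
      rw [if_pos h1, if_neg h1.asymm]
      ring
    · have h1 := lt_of_le_of_ne h hab.symm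
      rw [if_pos h1, if_neg h1.asymm]
      ring

theorem bdry_ins (a : P) {x : Finset P →₀ ℤ}
    (hx : x ∈ supported ℤ ℤ {s : Finset P | ∀ b ∈ s, a ≤ b ∨ b ≤ a}) :
    bdry (ins a x) = x - ins a (bdry x) := by
  have : (bdry ∘ₗ ins a - LinearMap.id + ins a ∘ₗ bdry :
      (Finset P →₀ ℤ) →ₗ[ℤ] (Finset P →₀ ℤ)) x ∈ (⊥ : Submodule ℤ (Finset P →₀ ℤ)) := by
    refine map_mem_of_mem_supported _ (fun s hs => ?_) hx
    simp [bdry_ins_single a s hs]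
  rw [Submodule.mem_bot] at this
  simp only [LinearMap.add_apply, LinearMap.sub_apply, LinearMap.comp_apply,
    LinearMap.id_apply] at this
  rw [eq_sub_iff_add_eq, ← sub_eq_zero, ← this]
  abel

theorem bdry_mem_supported {p : Set (Finset P)} (hp : ∀ s t, s ⊆ t → t ∈ p → s ∈ p)
    {x : Finset P →₀ ℤ} (hx : x ∈ supported ℤ ℤ p) : bdry x ∈ supported ℤ ℤ p := by
  classical
  refine map_mem_of_mem_supported _ (fun s hs => ?_) hx
  rw [bdry_single]
  exact Submodule.sum_mem _ fun a _ => Submodule.smul_mem _ _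
    (single_mem_supported ℤ 1 (hp _ _ (Finset.erase_subset a s) hs))

open scoped Classical in
theorem ins_mem_supported {p q : Set (Finset P)} {a : P} (hp : ∀ s ∈ p, insert a s ∈ q)
    {x : Finset P →₀ ℤ} (hx : x ∈ supported ℤ ℤ p) : ins a x ∈ supported ℤ ℤ q := by
  refine map_mem_of_mem_supported _ (fun s hs => ?_) hx
  rw [ins_single]
  split_ifs
  · exact Submodule.zero_mem _
  · exact Submodule.smul_mem _ _ (single_mem_supported ℤ 1 (hp s hs))

/-- A nonempty chain is, up to sign, the cone from one of its vertices over the rest, so the cone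
formula allows induction on the number of vertices. -/
theorem bdry_bdry_single (s : Finset P) (hs : IsChain (· ≤ ·) (s : Set P)) :
    bdry (bdry (single s 1)) = 0 := by
  classical
  induction s using Finset.induction_on with
  | empty => simp [bdry_single]
  | insert a s ha ih =>
    have hs' : IsChain (· ≤ ·) (s : Set P) := hs.mono (by simp)
    have h : ∀ b ∈ s, a ≤ b ∨ b ≤ a := fun b hb => by
      refine hs (by simp) (by simp [hb]) ?_
      rintro rfl
      exact ha hb
    have h1 : single (insert a s) (1 : ℤ) = sgn a s • ins a (single s 1) := by
      rw [ins_single, if_neg ha, smul_smul, sgn_mul_self, one_smul]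
    have h2 : single s (1 : ℤ) ∈ supported ℤ ℤ {s : Finset P | ∀ b ∈ s, a ≤ b ∨ b ≤ a} :=
      single_mem_supported ℤ 1 h
    have h3 := bdry_mem_supported (p := {s : Finset P | ∀ b ∈ s, a ≤ b ∨ b ≤ a})
      (fun s t hst ht b hb => ht b (hst hb)) h2
    rw [h1, map_smul, map_smul, bdry_ins a h2, map_sub, bdry_ins a h3, ih hs']
    simp

/-- The antisymmetrization of a list of vertices. -/
noncomputable def ofList : List P → (Finset P →₀ ℤ)
  | [] => single ∅ 1
  | a :: t => ins a (ofList t)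

/-- The chain map from the complex of lists to the complex of finite subsets. -/
noncomputable def antisymm : (List P →₀ ℤ) →ₗ[ℤ] (Finset P →₀ ℤ) :=
  lsum ℤ fun t => LinearMap.toSpanSingleton ℤ _ (ofList t)

theorem antisymm_single (t : List P) : antisymm (single t 1) = ofList t := by
  simp [antisymm]

theorem antisymm_cone (a : P) (x : List P →₀ ℤ) :
    antisymm (ListChain.cone a x) = ins a (antisymm x) := by
  have : antisymm ∘ₗ ListChain.cone a = ins a ∘ₗ antisymm := by
    ext t : 2
    simp [antisymm_single, ofList]
  exact LinearMap.congr_fun this x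

theorem ofList_mem_supported (t : List P) :
    ofList t ∈ supported ℤ ℤ {s : Finset P | ∀ b ∈ s, b ∈ t} := by
  classical
  induction t with
  | nil => exact single_mem_supported ℤ 1 (by simp)
  | cons a t ih =>
    refine ins_mem_supported (fun s hs b hb => ?_) ih
    rcases Finset.mem_insert.1 hb with rfl | hb
    · simp
    · exact List.mem_cons_of_mem _ (hs b hb)

/-- Both complexes satisfy the same cone formula, and antisymmetrization turns one cone into the
other. Lists with a repeated vertex are sent to `0`. -/
theorem bdry_antisymm {x : List P →₀ ℤ}
    (hx : x ∈ supported ℤ ℤ {t : List P | ∀ a ∈ t, ∀ b ∈ t, a ≤ b ∨ b ≤ a}) :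
    bdry (antisymm x) = antisymm (ListChain.bdry x) := by
  have : (bdry ∘ₗ antisymm - antisymm ∘ₗ ListChain.bdry :
      (List P →₀ ℤ) →ₗ[ℤ] (Finset P →₀ ℤ)) x ∈
      (⊥ : Submodule ℤ (Finset P →₀ ℤ)) := by
    refine map_mem_of_mem_supported _ (fun t ht => ?_) hx
    induction t with
    | nil => simp [antisymm_single, ofList, bdry_single]
    | cons a t ih =>
      have ih := ih fun a ha b hb => ht a (by simp [ha]) b (by simp [hb])
      simp only [Submodule.mem_bot, LinearMap.sub_apply, LinearMap.comp_apply, sub_eq_zero]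
        at ih ⊢
      rw [ListChain.bdry_cons, map_sub, antisymm_cone, ← ih, antisymm_single, antisymm_single,
        ofList, bdry_ins]
      refine supported_mono ?_ (ofList_mem_supported t)
      intro s hs b hb
      exact ht a (by simp) b (by simp [hs b hb])
  rwa [Submodule.mem_bot, LinearMap.sub_apply, sub_eq_zero] at this

theorem antisymm_mem_supported {p : Set (List P)} {q : Set (Finset P)}
    (h : ∀ t ∈ p, ∀ s : Finset P, (∀ b ∈ s, b ∈ t) → s ∈ q) {x : List P →₀ ℤ}
    (hx : x ∈ supported ℤ ℤ p) : antisymm x ∈ supported ℤ ℤ q := by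
  refine map_mem_of_mem_supported _ (fun t ht => ?_) hx
  rw [antisymm_single]
  exact supported_mono (h t ht) (ofList_mem_supported t)

/-- The method of acyclic carriers. -/
theorem exists_carried {D : Type*} [AddCommGroup D] (d : D →ₗ[ℤ] D)
    (φ : (Finset P →₀ ℤ) →ₗ[ℤ] D) (e : ℤ) (K : Set (Finset P))
    (hK : ∀ s ∈ K, IsChain (· ≤ ·) (s : Set P)) (hK' : ∀ s t, s ⊆ t → t ∈ K → s ∈ K)
    (Γ : Finset P → Submodule ℤ D) (hΓ : ∀ s t, s ⊆ t → Γ s ≤ Γ t)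
    (hφ : ∀ s ∈ K, φ (single s 1) ∈ Γ s)
    (hdφ : ∀ s ∈ K, d (φ (single s 1)) + e • φ (bdry (single s 1)) = 0)
    (hfill : ∀ s ∈ K, s.Nonempty → ∀ x ∈ Γ s, d x = 0 → ∃ y ∈ Γ s, d y = x)
    (y₀ : D) (hy₀ : y₀ ∈ Γ ∅) (hy₀' : d y₀ = φ (single ∅ 1)) (n : ℕ) :
    ∃ h : (Finset P →₀ ℤ) →ₗ[ℤ] D, h (single ∅ 1) = y₀ ∧ ∀ s ∈ K, s.card ≤ n →
      h (single s 1) ∈ Γ s ∧ d (h (single s 1)) = φ (single s 1) + e • h (bdry (single s 1)) := by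
  classical
  induction n with
  | zero =>
    -- Only the value at `∅` matters at this stage. The case `φ = 0`, `e = 1` of the construction
    -- produces chain maps, and `e = -1` produces chain homotopies.
    refine ⟨lsum ℤ fun s => LinearMap.toSpanSingleton ℤ _ y₀, by simp, fun s _ hs0 => ?_⟩
    obtain rfl : s = ∅ := by simpa using hs0
    simp [bdry_single, hy₀, hy₀']
  | succ n ih =>
    obtain ⟨h, h0, hh⟩ := ih
    have hface : ∀ s ∈ K, s.card ≤ n + 1 → ∀ a ∈ s, s.erase a ∈ K ∧ (s.erase a).card ≤ n :=
      fun s hs hsn a ha => ⟨hK' _ _ (Finset.erase_subset a s) hs, by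
        rw [Finset.card_erase_of_mem ha]
        omega⟩
    -- The prescribed boundary lies in `Γ s` since the carriers of the faces do, and it is a cycle
    -- by the equations already known on the faces; acyclicity of the carrier fills it.
    have hcyc : ∀ s ∈ K, s.card = n + 1 → ∃ y ∈ Γ s,
        d y = φ (single s 1) + e • h (bdry (single s 1)) := by
      intro s hs hsn
      refine hfill s hs (Finset.card_pos.1 (by omega)) _ ?_ ?_
      · refine Submodule.add_mem _ (hφ s hs) (Submodule.smul_mem _ _ ?_)
        rw [bdry_single, map_sum]
        refine Submodule.sum_mem _ fun a ha => ?_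
        rw [map_smul]
        exact Submodule.smul_mem _ _ (hΓ _ _ (Finset.erase_subset a s)
          (hh _ (hface s hs hsn.le a ha).1 (hface s hs hsn.le a ha).2).1)
      · have : d (h (bdry (single s 1))) =
            φ (bdry (single s 1)) + e • h (bdry (bdry (single s 1))) := by
          rw [bdry_single]
          simp only [map_sum, map_smul, Finset.smul_sum]
          rw [← Finset.sum_add_distrib]
          refine Finset.sum_congr rfl fun a ha => ?_
          rw [(hh _ (hface s hs hsn.le a ha).1 (hface s hs hsn.le a ha).2).2, smul_add,
            smul_comm e]
        rw [map_add, map_smul, this, bdry_bdry_single s (hK s hs), map_zero, smul_zero, add_zero,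
          hdφ s hs]
    choose! g hg hg' using hcyc
    let h' : (Finset P →₀ ℤ) →ₗ[ℤ] D := lsum ℤ fun s => LinearMap.toSpanSingleton ℤ _
      (if s.card ≤ n then h (single s 1) else g s)
    have h'_single : ∀ s, h' (single s 1) = if s.card ≤ n then h (single s 1) else g s := by
      intro s
      simp [h']
    have h'_bdry : ∀ s ∈ K, s.card ≤ n + 1 → h' (bdry (single s 1)) = h (bdry (single s 1)) := by
      intro s hs hsn
      rw [bdry_single, map_sum, map_sum]
      refine Finset.sum_congr rfl fun a ha => ?_
      rw [map_smul, map_smul, h'_single, if_pos (hface s hs hsn a ha).2]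
    refine ⟨h', by simp [h'_single, h0], fun s hs hsn => ?_⟩
    rw [h'_bdry s hs hsn, h'_single]
    split_ifs with hn
    · exact hh s hs hn
    · exact ⟨hg s hs (by omega), hg' s hs (by omega)⟩

end FinsetChain

/-! ### Simplicial acyclicity of contractible realizations -/

namespace OrderRealization

/-! ### Coordinate simplices and the cover by barycentric stars -/

section Coordinates

variable {P : Type u} {K : Finset P}

/-- The simplex spanned by the vertices in `s`, inside the real vector space on `K`. -/
def coordSimplex (K s : Finset P) : Set (K → ℝ) :=
  {x | (∀ i, 0 ≤ x i) ∧ ∑ i, x i = 1 ∧ ∀ i : K, (i : P) ∉ s → x i = 0}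

theorem convex_coordSimplex (K s : Finset P) : Convex ℝ (coordSimplex K s) := by
  rintro x ⟨hx0, hx1, hxs⟩ y ⟨hy0, hy1, hys⟩ a b ha hb hab
  refine ⟨fun i => ?_, ?_, fun i hi => ?_⟩
  · exact add_nonneg (mul_nonneg ha (hx0 i)) (mul_nonneg hb (hy0 i))
  · simp only [Pi.add_apply, Pi.smul_apply, smul_eq_mul, Finset.sum_add_distrib, ← Finset.mul_sum,
      hx1, hy1, mul_one, hab]
  · simp [hxs i hi, hys i hi]

theorem isCompact_coordSimplex (K s : Finset P) : IsCompact (coordSimplex K s) := by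
  refine (isCompact_univ_pi fun _ : K => isCompact_Icc (a := (0 : ℝ)) (b := 1)).of_isClosed_subset
    ?_ ?_
  · have : coordSimplex K s = {x | ∀ i, 0 ≤ x i} ∩ {x | ∑ i, x i = 1} ∩
        {x | ∀ i : K, (i : P) ∉ s → x i = 0} := by
      ext x
      simp [coordSimplex, and_assoc]
    rw [this]
    refine (IsClosed.inter ?_ ?_).inter ?_
    · simp only [Set.ofPred_forall]
      exact isClosed_iInter fun i => isClosed_le continuous_const (continuous_apply i)
    · exact isClosed_eq (continuous_finsetSum _ fun i _ => continuous_apply i) continuous_const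
    · simp only [Set.ofPred_forall]
      exact isClosed_iInter fun i => isClosed_iInter fun _ =>
        isClosed_eq (continuous_apply i) continuous_const
  · rintro x ⟨hx0, hx1, _⟩ i _
    exact ⟨hx0 i, hx1 ▸ Finset.single_le_sum (fun j _ => hx0 j) (Finset.mem_univ i)⟩

theorem coordSimplex_mono (K : Finset P) {s t : Finset P} (h : s ⊆ t) :
    coordSimplex K s ⊆ coordSimplex K t :=
  fun _ hx => ⟨hx.1, hx.2.1, fun i hi => hx.2.2 i fun his => hi (h his)⟩

theorem coordSimplex_nonempty {s : Finset P} (hs : s.Nonempty) (hsK : s ⊆ K) :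
    (coordSimplex K s).Nonempty := by
  classical
  obtain ⟨p, hp⟩ := hs
  refine ⟨Pi.single ⟨p, hsK hp⟩ 1, fun i => ?_, by simp, fun i hi => ?_⟩
  · by_cases h : i = ⟨p, hsK hp⟩
    · subst h
      simp
    · simp [h]
  · refine Pi.single_eq_of_ne ?_ _
    rintro rfl
    exact hi hp

open scoped Classical in
/-- The weights with the given coordinates in `K`. -/
noncomputable def extendWeight (x : K → ℝ) : P →₀ ℝ :=
  Finsupp.onFinset K (fun p => if h : p ∈ K then x ⟨p, h⟩ else 0) fun p hp => by
    by_contra h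
    simp [h] at hp

theorem extendWeight_apply_coe (x : K → ℝ) (i : K) : extendWeight x i = x i := by
  simp [extendWeight]

theorem extendWeight_of_notMem (x : K → ℝ) {p : P} (hp : p ∉ K) : extendWeight x p = 0 := by
  simp [extendWeight, hp]

theorem support_extendWeight_subset {s : Finset P} {x : K → ℝ} (hx : x ∈ coordSimplex K s) :
    (extendWeight x).support ⊆ s := by
  intro p hp
  by_contra h
  rw [Finsupp.mem_support_iff] at hp
  by_cases hK : p ∈ K
  · exact hp ((extendWeight_apply_coe x ⟨p, hK⟩).trans (hx.2.2 ⟨p, hK⟩ h))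
  · exact hp (extendWeight_of_notMem x hK)

end Coordinates

variable {P : Type u} [PartialOrder P]

theorem isOpen_iff {U : Set (OrderRealization P)} :
    IsOpen U ↔ ∀ s : Finset P, IsChain (· ≤ ·) (s : Set P) → ∃ V : Set (P → ℝ), IsOpen V ∧
      ∀ x ∈ closedSimplex s, (fun p => x.weight p) ∈ V ↔ x ∈ U := by
  unfold instTopologicalSpace
  rw [isOpen_iSup_iff, Subtype.forall]
  refine forall₂_congr fun s hs => ?_
  rw [isOpen_coinduced, isOpen_induced_iff]
  refine exists_congr fun V => and_congr_right fun _ => ?_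
  rw [Set.ext_iff, Subtype.forall]
  rfl

/-- The points whose coordinates at the vertices in `s` exceed all other coordinates: the open star
of the barycenter of `s` in the barycentric subdivision. -/
def barycentricStar (s : Finset P) : Set (OrderRealization P) :=
  {x | ∀ p ∈ s, 0 < x.weight p ∧ ∀ q, q ∉ s → x.weight q < x.weight p}

theorem isOpen_barycentricStar (s : Finset P) : IsOpen (barycentricStar s) := by
  classical
  rw [isOpen_iff]
  intro t _
  -- On the closed simplex of `t` the coordinates outside `t` vanish, so finitely many strict
  -- inequalities suffice.
  refine ⟨⋂ p ∈ s, ({y | 0 < y p} ∩ ⋂ q ∈ t.filter (· ∉ s), {y | y q < y p}), ?_, ?_⟩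
  · refine isOpen_biInter_finset fun p _ => IsOpen.inter ?_ (isOpen_biInter_finset fun q _ => ?_)
    · exact isOpen_lt continuous_const (continuous_apply p)
    · exact isOpen_lt (continuous_apply q) (continuous_apply p)
  · intro x hx
    simp only [Finset.mem_filter, Set.mem_iInter, Set.mem_inter_iff, Set.mem_ofPred_eq,
      barycentricStar]
    refine forall₂_congr fun p _ => and_congr_right fun hp => ⟨fun h q hq => ?_, fun h q hq => ?_⟩
    · by_cases hqt : q ∈ t
      · exact h q ⟨hqt, hq⟩
      · have : x.weight q = 0 := by
          by_contra h0
          exact hqt (hx (Finsupp.mem_support_iff.2 h0))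
        rwa [this]
    · exact h q hq.2

theorem exists_forall_weight_le (x : OrderRealization P) :
    ∃ p ∈ x.weight.support, ∀ q, x.weight q ≤ x.weight p := by
  have hne : x.weight.support.Nonempty := by
    rw [Finset.nonempty_iff_ne_empty]
    intro h
    have := x.sum_eq_one
    rw [Finsupp.sum, h] at this
    simp at this
  obtain ⟨p, hp, h⟩ := x.weight.support.exists_max_image x.weight hne
  refine ⟨p, hp, fun q => ?_⟩
  by_cases hq : q ∈ x.weight.support
  · exact h q hq
  · rw [Finsupp.notMem_support_iff.1 hq]
    exact x.nonneg p

/-- A vertex with the largest barycentric coordinate. -/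
noncomputable def dominantVertex (x : OrderRealization P) : P :=
  x.exists_forall_weight_le.choose

theorem dominantVertex_mem (x : OrderRealization P) : x.dominantVertex ∈ x.weight.support :=
  x.exists_forall_weight_le.choose_spec.1

theorem weight_le_dominantVertex (x : OrderRealization P) (q : P) :
    x.weight q ≤ x.weight x.dominantVertex :=
  x.exists_forall_weight_le.choose_spec.2 q

theorem dominantVertex_mem_of_mem_barycentricStar {s : Finset P} (hs : s.Nonempty)
    {x : OrderRealization P} (hx : x ∈ barycentricStar s) : x.dominantVertex ∈ s := by
  by_contra h
  obtain ⟨p, hp⟩ := hs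
  exact absurd (x.weight_le_dominantVertex p) (not_le.2 ((hx p hp).2 _ h))

/-- This forces a set with nonempty star to be a chain, so the dominant vertices of points in one
star are pairwise comparable. -/
theorem subset_support_of_mem_barycentricStar {s : Finset P} {x : OrderRealization P}
    (hx : x ∈ barycentricStar s) : s ⊆ x.weight.support :=
  fun p hp => Finsupp.mem_support_iff.2 (hx p hp).1.ne'

theorem exists_mem_barycentricStar (x : OrderRealization P) :
    ∃ s : Finset P, s.Nonempty ∧ x ∈ barycentricStar s := by
  classical
  -- All the vertices at which the coordinate is largest.
  refine ⟨x.weight.support.filter fun p => x.weight p = x.weight x.dominantVertex,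
    ⟨x.dominantVertex, by simpa using x.dominantVertex_mem⟩, ?_⟩
  intro p hp
  obtain ⟨hp, hpe⟩ := Finset.mem_filter.1 hp
  have hpos : 0 < x.weight p :=
    lt_of_le_of_ne (x.nonneg p) (Finsupp.mem_support_iff.1 hp).symm
  refine ⟨hpos, fun q hq => ?_⟩
  rw [hpe]
  refine lt_of_le_of_ne (x.weight_le_dominantVertex q) fun h => hq ?_
  rw [Finset.mem_filter, Finsupp.mem_support_iff]
  exact ⟨by rw [h, ← hpe]; exact hpos.ne', h⟩

variable {K : Finset P}

/-- The point of the realization with the given coordinates in `K`. -/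
noncomputable def ofCoord {s : Finset P} (hs : IsChain (· ≤ ·) (s : Set P)) {x : K → ℝ}
    (hx : x ∈ coordSimplex K s) : OrderRealization P where
  weight := extendWeight x
  nonneg p := by
    by_cases hK : p ∈ K
    · exact (hx.1 ⟨p, hK⟩).trans_eq (extendWeight_apply_coe x ⟨p, hK⟩).symm
    · exact (extendWeight_of_notMem x hK).ge
  sum_eq_one := by
    rw [Finsupp.sum_of_support_subset (s := K), ← Finset.sum_coe_sort]
    · simp only [extendWeight_apply_coe]
      exact hx.2.1
    · intro p hp
      by_contra h
      exact Finsupp.mem_support_iff.1 hp (extendWeight_of_notMem x h)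
    · simp
  isChain := hs.mono (by exact_mod_cast support_extendWeight_subset hx)

theorem continuous_ofCoord {s : Finset P} (hs : IsChain (· ≤ ·) (s : Set P)) :
    Continuous fun x : coordSimplex K s => ofCoord hs x.2 := by
  refine continuous_def.2 fun U hU => ?_
  obtain ⟨V, hV, hVU⟩ := isOpen_iff.1 hU s hs
  have hc : Continuous fun x : coordSimplex K s => fun p => extendWeight x.1 p := by
    refine continuous_pi fun p => ?_
    by_cases hK : p ∈ K
    · have : (fun x : coordSimplex K s => extendWeight x.1 p) = fun x => x.1 ⟨p, hK⟩ := by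
        funext x
        exact extendWeight_apply_coe x.1 ⟨p, hK⟩
      rw [this]
      exact (continuous_apply _).comp continuous_subtype_val
    · simp only [extendWeight_of_notMem _ hK]
      exact continuous_const
  convert hV.preimage hc using 1
  ext x
  exact (hVU _ (support_extendWeight_subset x.2)).symm

/-- A continuous family of points of the realization over a compact metric space can be subordinated
to the cover by barycentric stars. -/
theorem exists_lebesgue {X : Type*} [PseudoMetricSpace X] [CompactSpace X]
    {Φ : X → OrderRealization P} (hΦ : Continuous Φ) :
    ∃ ε > 0, ∀ x, ∃ s : Finset P, s.Nonempty ∧ ∀ y, dist y x < ε → Φ y ∈ barycentricStar s := by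
  obtain ⟨ε, hε, h⟩ := lebesgue_number_lemma_of_metric (isCompact_univ (X := X))
    (c := fun s : {s : Finset P // s.Nonempty} => Φ ⁻¹' barycentricStar s.1)
    (fun s => (isOpen_barycentricStar s.1).preimage hΦ)
    (fun x _ => by
      obtain ⟨s, hs, hx⟩ := exists_mem_barycentricStar (Φ x)
      exact Set.mem_iUnion.2 ⟨⟨s, hs⟩, hx⟩)
  refine ⟨ε, hε, fun x => ?_⟩
  obtain ⟨s, hs⟩ := h x (Set.mem_univ x)
  exact ⟨s.1, s.2, fun y hy => hs hy⟩

end OrderRealization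

/-! ### Simplicial approximation and filling of cycles -/

namespace OrderRealization

open Finsupp

variable {P : Type u} [PartialOrder P]

/-- The finite chains contained in `A`. -/
def chainsIn (A : Set P) : Set (Finset P) :=
  {s | IsChain (· ≤ ·) (s : Set P) ∧ (s : Set P) ⊆ A}

theorem chainsIn_of_subset {A : Set P} {s t : Finset P} (h : s ⊆ t) (ht : t ∈ chainsIn A) :
    s ∈ chainsIn A :=
  ⟨ht.1.mono (by exact_mod_cast h), (Finset.coe_subset.2 h).trans ht.2⟩

/-- The lists in a poset all of whose members lie in `A` and are pairwise comparable. -/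
def chainLists (A : Set P) : Set (List P) :=
  {t | (∀ a ∈ t, a ∈ A) ∧ ∀ a ∈ t, ∀ b ∈ t, a ≤ b ∨ b ≤ a}

theorem le_or_le_of_mem {s : Finset P} (hs : IsChain (· ≤ ·) (s : Set P)) {a b : P} (ha : a ∈ s)
    (hb : b ∈ s) : a ≤ b ∨ b ≤ a := by
  by_cases h : a = b
  · exact Or.inl h.le
  · exact hs ha hb h

theorem mem_chainsIn_of_mem_chainLists {A : Set P} {t : List P} (ht : t ∈ chainLists A)
    {s : Finset P} (hs : ∀ b ∈ s, b ∈ t) : s ∈ chainsIn A :=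
  ⟨fun a ha b hb _ => ht.2 a (hs a ha) b (hs b hb), fun a ha => ht.1 a (hs a ha)⟩

section Approximation

variable {A : Set P} {K : Finset P}

/-- The simplices of the finite subcomplex under consideration. -/
abbrev chainsInFinset (A : Set P) (K : Finset P) : Set (Finset P) :=
  {s | s ∈ chainsIn A ∧ s ⊆ K}

/-- A simplicial approximation to the inclusion of the finite subcomplex induces a map which is
chain homotopic to the identity. -/
theorem exists_homotopy (f : (K → ℝ) → P) {ε : ℝ} (hε : 0 < ε)
    (hf : ∀ s ∈ chainsInFinset A K, ∀ x ∈ coordSimplex K s, f x ∈ s) (z : Finset P →₀ ℤ)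
    (hz : z ∈ supported ℤ ℤ (chainsInFinset A K)) (hz0 : FinsetChain.bdry z = 0) :
    ∃ y ∈ supported ℤ ℤ {l | ∃ s ∈ chainsInFinset A K,
        l ∈ ListChain.smallLists (coordSimplex K s) ε}, ListChain.bdry y = 0 ∧
      ∃ w ∈ supported ℤ ℤ (chainsIn A),
        FinsetChain.bdry w = z - FinsetChain.antisymm (ListChain.push f y) := by
  classical
  have hcard : ∀ s ∈ chainsInFinset A K, s.card ≤ K.card := fun s hs => Finset.card_le_card hs.2
  have hchain : ∀ s ∈ chainsInFinset A K, IsChain (· ≤ ·) (s : Set P) := fun s hs => hs.1.1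
  have hsub : ∀ s t, s ⊆ t → t ∈ chainsInFinset A K → s ∈ chainsInFinset A K :=
    fun s t h ht => ⟨chainsIn_of_subset h ht.1, h.trans ht.2⟩
  have hempty : (∅ : Finset P) ∈ chainsInFinset A K := by simp [chainsInFinset, chainsIn]
  -- `θ` plays the role of an iterated subdivision: each simplex is carried to small lists of its
  -- own points, which are acyclic by convexity.
  obtain ⟨θ, hθ0, hθ⟩ := FinsetChain.exists_carried (D := List (K → ℝ) →₀ ℤ) ListChain.bdry 0 1
    (chainsInFinset A K) hchain hsub
    (fun s => supported ℤ ℤ (ListChain.smallLists (coordSimplex K s) ε))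
    (fun s t h => supported_mono (ListChain.smallLists_mono (coordSimplex_mono K h) ε))
    (fun s _ => by simp) (fun s _ => by simp)
    (fun s hs hne x hx hx0 => by
      obtain ⟨c, hc⟩ := coordSimplex_nonempty hne hs.2
      obtain ⟨D, hD⟩ := (isCompact_coordSimplex K s).isBounded.subset_closedBall c
      exact ListChain.exists_bdry_eq_of_convex (convex_coordSimplex K s) hc
        (fun x hx => hD hx) hε hx hx0)
    (single [] 1) (single_mem_supported ℤ 1 (by simp [ListChain.smallLists])) (by simp) K.card
  have hθb : ∀ s ∈ chainsInFinset A K,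
      ListChain.bdry (θ (single s 1)) = θ (FinsetChain.bdry (single s 1)) := by
    intro s hs
    simpa using (hθ s hs (hcard s hs)).2
  have hpush : ∀ s ∈ chainsInFinset A K, ListChain.push f (θ (single s 1)) ∈
      supported ℤ ℤ {t | ∀ b ∈ t, b ∈ s} := by
    intro s hs
    refine ListChain.push_mem_supported ?_ (hθ s hs (hcard s hs)).1
    intro t ht b hb
    obtain ⟨x, hx, rfl⟩ := List.mem_map.1 hb
    exact hf s hs x (ht.1 x hx)
  let m : (Finset P →₀ ℤ) →ₗ[ℤ] (Finset P →₀ ℤ) :=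
    FinsetChain.antisymm ∘ₗ ListChain.push f ∘ₗ θ
  have hm : ∀ s ∈ chainsInFinset A K,
      FinsetChain.bdry (m (single s 1)) = m (FinsetChain.bdry (single s 1)) := by
    intro s hs
    simp only [m, LinearMap.comp_apply]
    rw [FinsetChain.bdry_antisymm, ListChain.bdry_push, hθb s hs]
    refine supported_mono ?_ (hpush s hs)
    intro t ht a ha b hb
    exact le_or_le_of_mem hs.1.1 (ht a ha) (ht b hb)
  have hms : ∀ s ∈ chainsInFinset A K, m (single s 1) ∈ supported ℤ ℤ {t : Finset P | t ⊆ s} :=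
    fun s hs => FinsetChain.antisymm_mem_supported (p := {t : List P | ∀ b ∈ t, b ∈ s})
      (fun t ht r hr b hb => ht b (hr b hb)) (hpush s hs)
  -- Since `f` sends points of a simplex to its vertices, `m` and the identity are both carried by
  -- the full simplex, which is a cone from any of its vertices; hence they are homotopic. Both fix
  -- `∅`, so the homotopy may start with `0`.
  obtain ⟨h, h0, hh⟩ := FinsetChain.exists_carried FinsetChain.bdry (LinearMap.id - m) (-1)
    (chainsInFinset A K) hchain hsub (fun s => supported ℤ ℤ {t : Finset P | t ⊆ s})
    (fun s t hst => supported_mono fun r (hr : r ⊆ s) => hr.trans hst)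
    (fun s hs => Submodule.sub_mem _ (single_mem_supported ℤ 1 (Finset.Subset.refl s)) (hms s hs))
    (fun s hs => by
      rw [LinearMap.sub_apply, LinearMap.sub_apply, map_sub, hm s hs]
      simp)
    (fun s hs ⟨a, ha⟩ x hx hx0 => by
      refine ⟨FinsetChain.ins a x, FinsetChain.ins_mem_supported
        (fun t ht => Finset.insert_subset ha ht) hx, ?_⟩
      rw [FinsetChain.bdry_ins, hx0, map_zero, sub_zero]
      exact supported_mono (s := {t : Finset P | t ⊆ s})
        (t := {t : Finset P | ∀ b ∈ t, a ≤ b ∨ b ≤ a}) (fun t ht b hb => le_or_le_of_mem hs.1.1 ha (ht hb)) hx)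
    0 (Submodule.zero_mem _) (by
      simp [m, hθ0, FinsetChain.antisymm_single, FinsetChain.ofList]) K.card
  have hext : ∀ {M : Type u} [AddCommGroup M] (L L' : (Finset P →₀ ℤ) →ₗ[ℤ] M),
      (∀ s ∈ chainsInFinset A K, L (single s 1) = L' (single s 1)) → L z = L' z := by
    intro M _ L L' hL
    have : (L - L') z ∈ (⊥ : Submodule ℤ M) :=
      map_mem_of_mem_supported (L - L') (fun s hs => by simp [hL s hs]) hz
    simpa [sub_eq_zero] using this
  refine ⟨θ z, ?_, ?_, h z, ?_, ?_⟩
  · exact map_mem_of_mem_supported θ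
      (fun s hs => supported_mono (t := {l | ∃ s ∈ chainsInFinset A K,
        l ∈ ListChain.smallLists (coordSimplex K s) ε}) (fun l hl => ⟨s, hs, hl⟩) (hθ s hs (hcard s hs)).1) hz
  · have : (ListChain.bdry ∘ₗ θ - θ ∘ₗ FinsetChain.bdry) z ∈
        (⊥ : Submodule ℤ (List (K → ℝ) →₀ ℤ)) :=
      map_mem_of_mem_supported _ (fun s hs => by simp [hθb s hs]) hz
    simpa [hz0] using this
  · exact map_mem_of_mem_supported h
      (fun s hs => supported_mono (fun t ht => chainsIn_of_subset ht hs.1)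
        (hh s hs (hcard s hs)).1) hz
  · have := hext (FinsetChain.bdry ∘ₗ h) (LinearMap.id - m - h ∘ₗ FinsetChain.bdry)
      (fun s hs => by
        simp only [LinearMap.comp_apply, (hh s hs (hcard s hs)).2, LinearMap.sub_apply]
        simp [sub_eq_add_neg])
    simpa [hz0, m] using this

end Approximation

/-- If the part of the realization spanned by `A` is contractible, then the augmented simplicial
chain complex of `A` is acyclic. -/
theorem exists_bdry_eq_of_contractible (A : Set P)
    [hA : ContractibleSpace {x : OrderRealization P | (x.weight.support : Set P) ⊆ A}]
    (z : Finset P →₀ ℤ) (hz : z ∈ supported ℤ ℤ (chainsIn A)) (hz0 : FinsetChain.bdry z = 0) :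
    ∃ w ∈ supported ℤ ℤ (chainsIn A), FinsetChain.bdry w = z := by
  classical
  let Y : Type u := {x : OrderRealization P | (x.weight.support : Set P) ⊆ A}
  obtain ⟨y₀, ⟨F⟩⟩ := id_nullhomotopic Y
  -- Restricting to the vertices of `z` leaves finitely many simplices, so that compactness gives
  -- uniform constants.
  let K : Finset P := z.support.biUnion id
  have hzK : z ∈ supported ℤ ℤ (chainsInFinset A K) := fun s hs =>
    ⟨hz hs, Finset.subset_biUnion_of_mem id hs⟩
  let v : Y → P := fun y => y.1.dominantVertex
  have hvA : ∀ y, v y ∈ A := fun y => y.2 (dominantVertex_mem y.1)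
  let ρ : ∀ s ∈ chainsInFinset A K, coordSimplex K s → Y := fun s hs x =>
    ⟨ofCoord hs.1.1 x.2, (Finset.coe_subset.2 (support_extendWeight_subset x.2)).trans hs.1.2⟩
  have hρ : ∀ s hs, Continuous (ρ s hs) := fun s hs =>
    (continuous_ofCoord hs.1.1).subtype_mk _
  have hρ' : ∀ s hs t ht (x : K → ℝ) (hxs : x ∈ coordSimplex K s) (hxt : x ∈ coordSimplex K t),
      ρ s hs ⟨x, hxs⟩ = ρ t ht ⟨x, hxt⟩ := fun s hs t ht x hxs hxt => rfl
  have hleb : ∀ s (hs : s ∈ chainsInFinset A K), ∃ ε > 0, ∀ (x : coordSimplex K s)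
      (τ : unitInterval), ∃ r : Finset P, r.Nonempty ∧ ∀ (x' : coordSimplex K s)
        (τ' : unitInterval), dist x' x < ε → dist τ' τ < ε →
        (F (τ', ρ s hs x')).1 ∈ barycentricStar r := by
    intro s hs
    have : CompactSpace (coordSimplex K s) :=
      isCompact_iff_compactSpace.1 (isCompact_coordSimplex K s)
    obtain ⟨ε, hε, h⟩ := exists_lebesgue (X := coordSimplex K s × unitInterval)
      (Φ := fun xτ => (F (xτ.2, ρ s hs xτ.1)).1)
      (continuous_subtype_val.comp
        (F.continuous.comp (continuous_snd.prodMk ((hρ s hs).comp continuous_fst))))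
    refine ⟨ε, hε, fun x τ => ?_⟩
    obtain ⟨r, hr, h⟩ := h (x, τ)
    exact ⟨r, hr, fun x' τ' hx hτ => h (x', τ') (max_lt hx hτ)⟩
  choose! ε₀ hε₀ hleb using hleb
  obtain ⟨ε, hε, hεle⟩ : ∃ ε > 0, ∀ s ∈ K.powerset, s ∈ chainsInFinset A K → ε ≤ ε₀ s := by
    have h1 : ∀ᶠ ε in nhdsWithin (0 : ℝ) (Set.Ioi 0),
        ∀ s ∈ K.powerset, s ∈ chainsInFinset A K → ε ≤ ε₀ s := by
      rw [Filter.eventually_all_finset]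
      intro s _
      by_cases hs : s ∈ chainsInFinset A K
      · filter_upwards [Ioo_mem_nhdsGT (hε₀ s hs)] with ε hε _ using hε.2.le
      · exact Filter.Eventually.of_forall fun ε h => absurd h hs
    obtain ⟨ε, h, hε⟩ := (h1.and self_mem_nhdsWithin).exists
    exact ⟨ε, hε, h⟩
  -- The time step `1 / N` is below the common Lebesgue number as well, so both ends of a step stay
  -- in one star.
  obtain ⟨N, hN⟩ := exists_nat_gt (1 / ε)
  have hN0 : (0 : ℝ) < N := lt_trans (by positivity) hN
  have hNε : 1 / (N : ℝ) < ε := by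
    rw [div_lt_iff₀ hε] at hN
    rw [div_lt_iff₀ hN0]
    linarith
  let τ : ℕ → unitInterval := fun k => Set.projIcc 0 1 zero_le_one ((k : ℝ) / N)
  have hτ : ∀ k, dist (τ (k + 1)) (τ k) < ε := by
    intro k
    refine lt_of_le_of_lt ?_ hNε
    have := Set.abs_projIcc_sub_projIcc (c := ((k + 1 : ℕ) : ℝ) / N) (d := (k : ℝ) / N)
      (zero_le_one (α := ℝ))
    rw [Subtype.dist_eq, Real.dist_eq]
    refine this.trans_eq ?_
    rw [← sub_div, Nat.cast_succ, add_sub_cancel_left, abs_of_pos (by positivity)]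
  -- The simplex chosen for `x` is immaterial, because the point built from the coordinates does not
  -- depend on it. The default `v y₀` makes `f N` constant on the whole space.
  let f : ℕ → (K → ℝ) → P := fun k x =>
    if h : ∃ s, ∃ hs : s ∈ chainsInFinset A K, x ∈ coordSimplex K s then
      v (F (τ k, ρ h.choose h.choose_spec.choose ⟨x, h.choose_spec.choose_spec⟩)) else v y₀
  have hf : ∀ k s (hs : s ∈ chainsInFinset A K) (x : K → ℝ) (hx : x ∈ coordSimplex K s),
      f k x = v (F (τ k, ρ s hs ⟨x, hx⟩)) := by
    intro k s hs x hx
    have h : ∃ s, ∃ hs : s ∈ chainsInFinset A K, x ∈ coordSimplex K s := ⟨s, hs, hx⟩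
    simp only [f, dif_pos h]
    rfl
  have hfA : ∀ k x, f k x ∈ A := by
    intro k x
    simp only [f]
    split_ifs
    · exact hvA _
    · exact hvA _
  have hτ0 : τ 0 = 0 := by
    simp [τ]
  have hτN : τ N = 1 := by
    simp [τ, div_self hN0.ne']
  -- At time `0` the homotopy is the identity, and the dominant vertex of a point belongs to its
  -- support; this is the simplicial approximation condition.
  obtain ⟨y, hy, hy0, w, hw, hw'⟩ := exists_homotopy (f 0) hε (fun s hs x hx => by
    rw [hf 0 s hs x hx, hτ0, F.apply_zero]
    exact support_extendWeight_subset hx (dominantVertex_mem _)) z hzK hz0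
  have := ListChain.exists_bdry_eq_push (q := chainLists A) f N (v y₀) ?_ ?_ ?_ hy hy0
  · obtain ⟨w', hw₁, hw₂⟩ := this
    refine ⟨w + FinsetChain.antisymm w', Submodule.add_mem _ hw ?_, ?_⟩
    · exact FinsetChain.antisymm_mem_supported
        (fun t ht s hs => mem_chainsIn_of_mem_chainLists ht hs) hw₁
    · rw [map_add, hw', FinsetChain.bdry_antisymm, hw₂]
      · abel
      · exact supported_mono (fun t ht => ht.2) hw₁
  · intro x
    simp only [f, hτN, F.apply_one]
    split_ifs <;> rfl
  · rintro k hk t ⟨s, hs, htC, htε⟩ l hl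
    refine ⟨fun b hb => ?_, ?_⟩
    · obtain ⟨x, _, rfl | rfl⟩ := hl b hb
      · exact hfA _ _
      · exact hfA _ _
    · cases t with
      | nil =>
        intro a ha
        obtain ⟨x, hx, _⟩ := hl a ha
        simp at hx
      | cons x₀ t =>
        have hle := hεle s (Finset.mem_powerset.2 hs.2) hs
        have hx₀ := htC x₀ (by simp)
        -- A single star, chosen around `x₀` at time `τ k`, contains the images of all points of the
        -- list at both times, so all vertices of the prism lie in the chain `r`.
        obtain ⟨r, hr, h⟩ := hleb s hs ⟨x₀, hx₀⟩ (τ k)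
        have hmem : ∀ b ∈ l, b ∈ r := by
          intro b hb
          obtain ⟨x, hx, hb⟩ := hl b hb
          have hxx : dist (⟨x, htC x hx⟩ : coordSimplex K s) ⟨x₀, hx₀⟩ < ε₀ s :=
            lt_of_lt_of_le (htε x hx x₀ (by simp)) hle
          rcases hb with rfl | rfl
          · rw [hf k s hs x (htC x hx)]
            exact dominantVertex_mem_of_mem_barycentricStar hr
              (h _ _ hxx (by rw [dist_self]; exact hε₀ s hs))
          · rw [hf (k + 1) s hs x (htC x hx)]
            exact dominantVertex_mem_of_mem_barycentricStar hr
              (h _ _ hxx ((hτ k).trans_le hle))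
        have h0 := h ⟨x₀, hx₀⟩ (τ k) (by rw [dist_self]; exact hε₀ s hs)
          (by rw [dist_self]; exact hε₀ s hs)
        have hchain : IsChain (· ≤ ·) (r : Set P) := (F (τ k, ρ s hs ⟨x₀, hx₀⟩)).1.isChain.mono
          (by exact_mod_cast subset_support_of_mem_barycentricStar h0)
        intro a ha b hb
        exact le_or_le_of_mem hchain (hmem a ha) (hmem b hb)
  · intro s hs
    refine ⟨fun a ha => hs a ha ▸ hvA y₀, fun a ha b hb => ?_⟩
    rw [hs a ha, hs b hb]
    exact Or.inl le_rfl

end OrderRealization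

/-! ### Lengths of projective resolutions -/

namespace CategoryTheory

open Limits

universe w w'

variable {C : Type w} [Category.{w'} C] [Abelian C]

/-- `K` together with the augmentation `ε` is a projective resolution of `Z`. -/
structure IsProjectiveResolution (K : ChainComplex C ℕ) {Z : C} (ε : K.X 0 ⟶ Z) : Prop where
  projective : ∀ n, Projective (K.X n)
  d_comp : K.d 1 0 ≫ ε = 0
  epi : Epi ε
  exact_zero : (ShortComplex.mk (K.d 1 0) ε d_comp).Exact
  exact_succ : ∀ n, (ShortComplex.mk _ _ (K.d_comp_d (n + 2) (n + 1) n)).Exact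

/-- Every cocycle of degree `n + 1` of the complex `Hom(K, M)` is a coboundary. -/
def CocyclesBound (K : ChainComplex C ℕ) (n : ℕ) (M : C) : Prop :=
  ∀ f : K.X (n + 1) ⟶ M, K.d (n + 2) (n + 1) ≫ f = 0 → ∃ g : K.X n ⟶ M, K.d (n + 1) n ≫ g = f

namespace IsProjectiveResolution

variable {K : ChainComplex C ℕ} {Z : C} {ε : K.X 0 ⟶ Z}

/-- The bundled projective resolution. -/
noncomputable def toProjectiveResolution (h : IsProjectiveResolution K ε) :
    ProjectiveResolution Z where
  complex := K
  projective := h.projective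
  π := (ChainComplex.toSingle₀Equiv _ _).symm ⟨ε, h.d_comp⟩
  quasiIso := ⟨fun n => by
    obtain _ | n := n
    · rw [ChainComplex.quasiIsoAt₀_iff, ShortComplex.quasiIso_iff_of_zeros']
      · refine (ShortComplex.exact_and_epi_g_iff_of_iso ?_).2 ⟨h.exact_zero, h.epi⟩
        exact ShortComplex.isoMk (Iso.refl _) (Iso.refl _) (Iso.refl _)
          ((Category.id_comp _).trans (Category.comp_id _).symm)
          ((Category.id_comp _).trans (Eq.trans
            (ChainComplex.toSingle₀Equiv_symm_apply_f_zero ε h.d_comp).symm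
            (Category.comp_id _).symm))
      · exact K.shape _ _ (by simp)
      all_goals rfl
    · rw [quasiIsoAt_iff_exactAt']
      · rw [HomologicalComplex.exactAt_iff' _ (n + 2) (n + 1) n (by simp) (by simp)]
        exact h.exact_succ n
      · apply ChainComplex.exactAt_succ_single_obj⟩

/-- The first differential of a resolution, with values in the kernel of the augmentation. -/
noncomputable def toSyzygy (h : IsProjectiveResolution K ε) : K.X 1 ⟶ kernel ε :=
  kernel.lift _ (K.d 1 0) h.d_comp

@[simp]
theorem toSyzygy_ι (h : IsProjectiveResolution K ε) : h.toSyzygy ≫ kernel.ι ε = K.d 1 0 :=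
  kernel.lift_ι _ _ _

theorem d_toSyzygy (h : IsProjectiveResolution K ε) : K.d 2 1 ≫ h.toSyzygy = 0 := by
  rw [← cancel_mono (kernel.ι ε), Category.assoc, toSyzygy_ι, zero_comp, K.d_comp_d]

theorem epi_toSyzygy (h : IsProjectiveResolution K ε) : Epi h.toSyzygy :=
  h.exact_zero.epi_kernelLift

/-- A resolution induces one of the kernel of its augmentation. -/
theorem syzygy (h : IsProjectiveResolution K ε) :
    IsProjectiveResolution (ChainComplex.truncate.obj K) (Z := kernel ε) h.toSyzygy where
  projective n := h.projective (n + 1)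
  d_comp := h.d_toSyzygy
  epi := h.epi_toSyzygy
  exact_zero := by
    let φ : ShortComplex.mk _ _ h.d_toSyzygy ⟶ ShortComplex.mk _ _ (K.d_comp_d 2 1 0) :=
      { τ₁ := 𝟙 _, τ₂ := 𝟙 _, τ₃ := kernel.ι ε
        comm₂₃ := by
          dsimp only
          rw [toSyzygy_ι, Category.id_comp] }
    have : Epi φ.τ₁ := inferInstanceAs (Epi (𝟙 _))
    have : IsIso φ.τ₂ := inferInstanceAs (IsIso (𝟙 _))
    have : Mono φ.τ₃ := inferInstanceAs (Mono (kernel.ι ε))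
    exact (ShortComplex.exact_iff_of_epi_of_isIso_of_mono φ).2 (h.exact_succ 0)
  exact_succ n := h.exact_succ (n + 1)

theorem augment_d_comp {P : C} {π : P ⟶ Z} {K : ChainComplex C ℕ} {ε : K.X 0 ⟶ kernel π}
    (h : IsProjectiveResolution K ε) : K.d 1 0 ≫ ε ≫ kernel.ι π = 0 := by
  rw [← Category.assoc, h.d_comp, zero_comp]

/-- A resolution of the kernel of an epimorphism from a projective object induces one of its
target. -/
theorem augment {P : C} (hP : Projective P) {π : P ⟶ Z} (hπ : Epi π) {K : ChainComplex C ℕ}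
    {ε : K.X 0 ⟶ kernel π} (h : IsProjectiveResolution K ε) :
    IsProjectiveResolution (ChainComplex.augment K (ε ≫ kernel.ι π) h.augment_d_comp)
      (Z := Z) π where
  projective n := by
    cases n
    · exact hP
    · exact h.projective _
  d_comp := by
    change (ε ≫ kernel.ι π) ≫ π = 0
    rw [Category.assoc, kernel.condition, comp_zero]
  epi := hπ
  exact_zero := by
    have w : (ε ≫ kernel.ι π) ≫ π = 0 := by
      rw [Category.assoc, kernel.condition, comp_zero]
    change (ShortComplex.mk (ε ≫ kernel.ι π) π w).Exact
    let φ : ShortComplex.mk (ε ≫ kernel.ι π) π w ⟶ ShortComplex.mk _ _ (kernel.condition π) :=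
      { τ₁ := ε, τ₂ := 𝟙 _, τ₃ := 𝟙 _ }
    have : Epi φ.τ₁ := h.epi
    have : IsIso φ.τ₂ := inferInstanceAs (IsIso (𝟙 _))
    have : Mono φ.τ₃ := inferInstanceAs (Mono (𝟙 _))
    exact (ShortComplex.exact_iff_of_epi_of_isIso_of_mono φ).2
      (ShortComplex.exact_of_f_is_kernel _ (kernelIsKernel π))
  exact_succ n := by
    cases n with
    | zero =>
      change (ShortComplex.mk (K.d 1 0) (ε ≫ kernel.ι π) h.augment_d_comp).Exact
      let φ : ShortComplex.mk _ _ h.d_comp ⟶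
          ShortComplex.mk (K.d 1 0) (ε ≫ kernel.ι π) h.augment_d_comp :=
        { τ₁ := 𝟙 _, τ₂ := 𝟙 _, τ₃ := kernel.ι π }
      have : Epi φ.τ₁ := inferInstanceAs (Epi (𝟙 _))
      have : IsIso φ.τ₂ := inferInstanceAs (IsIso (𝟙 _))
      have : Mono φ.τ₃ := inferInstanceAs (Mono (kernel.ι π))
      exact (ShortComplex.exact_iff_of_epi_of_isIso_of_mono φ).1 h.exact_zero
    | succ n => exact h.exact_succ n

theorem projective_target (h : IsProjectiveResolution K ε)
    (hK : ∀ M, CocyclesBound K 0 M) : Projective Z := by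
  have := h.epi_toSyzygy
  have := h.epi
  have := h.projective 0
  -- The map from `K.X 1` onto the syzygy is itself a cocycle. That it extends over `K.X 0` retracts
  -- `K.X 0` onto the kernel of `ε`, hence splits `ε`.
  obtain ⟨g, hg⟩ := hK (kernel ε) h.toSyzygy h.d_toSyzygy
  have hs : kernel.ι ε ≫ g = 𝟙 _ := by
    rw [← cancel_epi h.toSyzygy, reassoc_of% toSyzygy_ι, Category.comp_id]
    exact hg
  have hker : kernel.ι ε ≫ (𝟙 _ - g ≫ kernel.ι ε) = 0 := by
    rw [Preadditive.comp_sub, reassoc_of% hs, Category.comp_id, sub_self]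
  let s : Z ⟶ K.X 0 := (Abelian.epiIsCokernelOfKernel _ (kernelIsKernel ε)).desc
    (CokernelCofork.ofπ _ hker)
  have hs' : ε ≫ s = 𝟙 _ - g ≫ kernel.ι ε :=
    (Abelian.epiIsCokernelOfKernel _ (kernelIsKernel ε)).fac (CokernelCofork.ofπ _ hker)
      WalkingParallelPair.one
  have hsε : s ≫ ε = 𝟙 Z := by
    rw [← cancel_epi ε, reassoc_of% hs', Preadditive.sub_comp, Category.assoc, kernel.condition]
    simp
  exact Retract.projective ⟨s, ε, hsε⟩

/-- If all cocycles of degree `d + 1` with arbitrary coefficients are coboundaries, then there is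
a resolution of length `d`. -/
theorem exists_length_le (d : ℕ) {Z : C} {K : ChainComplex C ℕ} {ε : K.X 0 ⟶ Z}
    (h : IsProjectiveResolution K ε) (hK : ∀ M, CocyclesBound K d M) :
    ∃ (L : ChainComplex C ℕ) (η : L.X 0 ⟶ Z), IsProjectiveResolution L η ∧
      ∀ i, d < i → IsZero (L.X i) := by
  induction d generalizing Z K with
  | zero =>
    have := h.projective_target hK
    let S := ProjectiveResolution.self Z
    refine ⟨(ChainComplex.single₀ C).obj Z, 𝟙 Z, ⟨S.projective, ?_, ?_, ?_, ?_⟩, ?_⟩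
    · exact (congrArg (· ≫ 𝟙 Z) (HomologicalComplex.single_obj_d _ _ _ _ _)).trans zero_comp
    · exact inferInstanceAs (Epi (𝟙 Z))
    · exact S.exact₀
    · exact S.exact_succ
    · intro i hi
      exact HomologicalComplex.isZero_single_obj_X _ _ _ _ hi.ne'
  | succ d ih =>
    -- Dimension shifting: the truncated complex resolves the first syzygy, and its cocycles are
    -- those of `K` one degree higher.
    obtain ⟨L, η, hL, hL0⟩ := ih h.syzygy fun M f hf => hK M f hf
    refine ⟨_, _, augment (h.projective 0) h.epi hL, fun i hi => ?_⟩
    obtain ⟨i, rfl⟩ : ∃ j, i = j + 1 := ⟨i - 1, by omega⟩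
    exact hL0 i (by omega)

end IsProjectiveResolution

/-- If there is a resolution which vanishes in degree `n + 1`, then all cocycles of this degree are
coboundaries. -/
theorem ProjectiveResolution.cocyclesBound_of_isZero {Z : C} (R S : ProjectiveResolution Z) (n : ℕ)
    (hS : IsZero (S.complex.X (n + 1))) (M : C) : CocyclesBound R.complex n M := by
  intro f hf
  -- The composite `R ⟶ S ⟶ R` vanishes in degree `n + 1`, so there the identity is, up to sign, a
  -- sum of the two homotopy terms; one of them is killed by the cocycle `f` and the other exhibits
  -- it as a coboundary.
  have hc := (homotopyEquiv R S).homotopyHomInvId.comm (n + 1)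
  rw [Homotopy.dNext_succ_chainComplex, Homotopy.prevD_chainComplex, HomologicalComplex.comp_f,
    hS.eq_zero_of_tgt ((homotopyEquiv R S).hom.f (n + 1)), zero_comp] at hc
  have hc' := congrArg (· ≫ f) hc
  simp only [zero_comp, Preadditive.add_comp, Category.assoc, hf, comp_zero, add_zero,
    HomologicalComplex.id_f, Category.id_comp] at hc'
  refine ⟨-((homotopyEquiv R S).homotopyHomInvId.hom n (n + 1) ≫ f), ?_⟩
  rw [Preadditive.comp_neg, neg_eq_iff_add_eq_zero]
  exact hc'.symm

end CategoryTheory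

/-! ### The bar complex of a functor on a poset -/

namespace OrderBar

open CategoryTheory Opposite

section Simplices

variable {Q : Type u} [PartialOrder Q]

/-- The simplices of the realization of the whole poset. -/
abbrev Simplex (Q : Type u) [PartialOrder Q] (n : ℕ) : Type u := OrderSimplex (Set.univ : Set Q) n

/-- The initial vertex of a simplex. -/
def init {n : ℕ} (σ : Simplex Q n) : Q := σ.1 0

theorem le_face {n : ℕ} (σ : Simplex Q (n + 1)) (i : Fin (n + 2)) : init σ ≤ init (σ.face i) :=
  σ.2.1.monotone (Fin.zero_le _)

/-- The identity is universal: it holds in the free abelian group on the simplices, where each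
coefficient is an instance of the integral identity for cochains. -/
theorem sum_face_face {A : Type*} [AddCommGroup A] {n : ℕ} (f : Simplex Q n → A)
    (σ : Simplex Q (n + 2)) :
    ∑ i : Fin (n + 3), (-1 : ℤ) ^ (i : ℕ) • ∑ j : Fin (n + 2),
      (-1 : ℤ) ^ (j : ℕ) • f ((σ.face i).face j) = 0 := by
  classical
  have h : ∑ i : Fin (n + 3), (-1 : ℤ) ^ (i : ℕ) • ∑ j : Fin (n + 2), (-1 : ℤ) ^ (j : ℕ) •
      Finsupp.single ((σ.face i).face j) (1 : ℤ) = 0 := by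
    ext τ
    have := congrFun (simplicialCoboundary_comp Set.univ n fun ρ => Finsupp.single ρ (1 : ℤ) τ) σ
    simp only [Finsupp.finsetSum_apply, Finsupp.smul_apply, smul_eq_mul]
    exact this
  have := congrArg (Finsupp.liftAddHom fun τ => (zmultiplesHom A) (f τ)) h
  simpa [-zsmul_eq_mul, -Finsupp.smul_single, map_zsmul] using this

theorem linearCombination_single_one {ι R A : Type*} [Semiring R] [AddCommMonoid A] [Module R A]
    (v : ι → A) (i : ι) : Finsupp.linearCombination R v (.single i 1) = v i := by
  simp

end Simplices

variable {Q : Type u} [PartialOrder Q] {𝒞 : Type (max u v)} [SmallCategory 𝒞] (p : Q ⥤ 𝒞)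

/-- The basis of the bar construction at `X`. -/
structure Basis (n : ℕ) (X : 𝒞) : Type (max u v) where
  /-- The underlying simplex. -/
  simplex : Simplex Q n
  /-- The morphism to the object at the initial vertex. -/
  hom : X ⟶ p.obj (init simplex)

variable {p}

/-- The faces of the basis elements. -/
def Basis.face {n : ℕ} {X : 𝒞} (b : Basis p (n + 1) X) (i : Fin (n + 2)) : Basis p n X :=
  ⟨b.simplex.face i, b.hom ≫ p.map (homOfLE (le_face b.simplex i))⟩

/-- Precomposition of a basis element with a morphism. -/
def Basis.precomp {n : ℕ} {X Y : 𝒞} (f : Y ⟶ X) (b : Basis p n X) : Basis p n Y :=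
  ⟨b.simplex, f ≫ b.hom⟩

theorem Basis.face_precomp {n : ℕ} {X Y : 𝒞} (f : Y ⟶ X) (b : Basis p (n + 1) X)
    (i : Fin (n + 2)) : (b.precomp f).face i = (b.face i).precomp f := by
  simp [Basis.face, Basis.precomp]

/-- The boundary operator of the bar complex at an object. -/
noncomputable def bdry (n : ℕ) (X : 𝒞) : (Basis p (n + 1) X →₀ ℤ) →ₗ[ℤ] (Basis p n X →₀ ℤ) :=
  Finsupp.linearCombination ℤ fun b => ∑ i : Fin (n + 2), (-1 : ℤ) ^ (i : ℕ) • .single (b.face i) 1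

theorem bdry_single {n : ℕ} {X : 𝒞} (b : Basis p (n + 1) X) :
    bdry n X (.single b 1) = ∑ i : Fin (n + 2), (-1 : ℤ) ^ (i : ℕ) • .single (b.face i) 1 := by
  simp [bdry]

theorem bdry_bdry {n : ℕ} {X : 𝒞} (x : Basis p (n + 2) X →₀ ℤ) :
    bdry n X (bdry (n + 1) X x) = 0 := by
  classical
  have : bdry (p := p) n X ∘ₗ bdry (n + 1) X = 0 := by
    refine Finsupp.lhom_ext' fun b => LinearMap.ext_ring ?_
    -- Iterated faces have initial vertex above that of `b`, so the default `0` is never attained.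
    let f : Simplex Q n → (Basis p n X →₀ ℤ) := fun τ =>
      if h : init b.simplex ≤ init τ then .single ⟨τ, b.hom ≫ p.map (homOfLE h)⟩ 1 else 0
    simp only [LinearMap.comp_apply, Finsupp.lsingle_apply, bdry_single, map_sum, map_smul]
    refine Eq.trans (Finset.sum_congr rfl fun i _ => congrArg _
      (Finset.sum_congr rfl fun j _ => congrArg _ ?_)) (sum_face_face f b.simplex)
    have h : init b.simplex ≤ init ((b.simplex.face i).face j) :=
      (le_face _ _).trans (le_face _ _)
    simp only [f, dif_pos h, Basis.face, Category.assoc, ← p.map_comp]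
    rfl
  exact LinearMap.congr_fun this x

theorem mapDomain_bdry {n : ℕ} {X Y : 𝒞} (f : Y ⟶ X) (x : Basis p (n + 1) X →₀ ℤ) :
    bdry n Y (Finsupp.lmapDomain ℤ ℤ (Basis.precomp f) x) =
      Finsupp.lmapDomain ℤ ℤ (Basis.precomp f) (bdry n X x) := by
  have : bdry (p := p) n Y ∘ₗ Finsupp.lmapDomain ℤ ℤ (Basis.precomp f) =
      Finsupp.lmapDomain ℤ ℤ (Basis.precomp f) ∘ₗ bdry n X := by
    ext b : 2
    simp [bdry_single, Basis.face_precomp, -zsmul_eq_mul, -Finsupp.smul_single]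
  exact LinearMap.congr_fun this x

variable (p)

/-- The free functor spanned by the `n`-simplices. -/
noncomputable def obj (n : ℕ) : 𝒞ᵒᵖ ⥤ ModuleCat.{max u v} ℤ where
  obj X := ModuleCat.of ℤ (Basis p n X.unop →₀ ℤ)
  map f := ModuleCat.ofHom (Finsupp.lmapDomain ℤ ℤ (Basis.precomp f.unop))
  map_id X := by
    refine ModuleCat.hom_ext (Finsupp.lhom_ext' fun b => LinearMap.ext_ring ?_)
    simp [Basis.precomp]
  map_comp f g := by
    refine ModuleCat.hom_ext (Finsupp.lhom_ext' fun b => LinearMap.ext_ring ?_)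
    simp [Basis.precomp]

/-- The differential of the bar complex. -/
noncomputable def d (n : ℕ) : obj p (n + 1) ⟶ obj p n where
  app X := ModuleCat.ofHom (bdry n X.unop)
  naturality X Y f := by
    refine ModuleCat.hom_ext (LinearMap.ext fun x => ?_)
    exact mapDomain_bdry f.unop x

/-- The bar complex of a functor on a poset. -/
noncomputable def complex : ChainComplex (𝒞ᵒᵖ ⥤ ModuleCat.{max u v} ℤ) ℕ :=
  ChainComplex.of (obj p) (d p) fun n => by
    refine NatTrans.ext (funext fun X => ModuleCat.hom_ext (LinearMap.ext fun x => ?_))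
    exact bdry_bdry x

theorem complex_d (n : ℕ) : (complex p).d (n + 1) n = d p n := ChainComplex.of_d ..

variable {p} {M : 𝒞ᵒᵖ ⥤ ModuleCat.{max u v} ℤ}

/-- The components of a cochain. -/
noncomputable def component {n : ℕ} (f : obj p n ⟶ M) (X : 𝒞) :
    (Basis p n X →₀ ℤ) →+ M.obj (op X) :=
  (f.app (op X)).hom.toAddMonoidHom

/-- The value of a cochain at a simplex. -/
noncomputable def eval {n : ℕ} (f : obj p n ⟶ M) (σ : Simplex Q n) : M.obj (op (p.obj (init σ))) :=
  component f (p.obj (init σ)) (.single ⟨σ, 𝟙 _⟩ 1)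

/-- By the Yoneda argument, a basis element is the restriction along `b.hom` of the identity over
the same simplex; hence cochains are freely determined by their values on simplices. -/
theorem component_single {n : ℕ} (f : obj p n ⟶ M) {X : 𝒞} (b : Basis p n X) :
    component f X (.single b 1) = (M.map b.hom.op).hom (eval f b.simplex) := by
  have := congrArg (fun g => g.hom (Finsupp.single (⟨b.simplex, 𝟙 _⟩ : Basis p n _) (1 : ℤ)))
    (f.naturality b.hom.op)
  refine Eq.trans (congrArg (f.app (op X)).hom ?_) this
  refine Eq.trans ?_ (Finsupp.mapDomain_single (f := Basis.precomp b.hom)).symm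
  simp only [Basis.precomp, Category.comp_id]
  rfl

theorem hom_ext {n : ℕ} {f g : obj p n ⟶ M} (h : ∀ σ, eval f σ = eval g σ) : f = g := by
  refine NatTrans.ext (funext fun X => ModuleCat.hom_ext (Finsupp.lhom_ext' fun b => ?_))
  refine LinearMap.ext_ring ?_
  have := component_single f (X := X.unop) b
  rw [h, ← component_single g] at this
  exact this

/-- The cochain with given values at the simplices. -/
noncomputable def ofValues {n : ℕ} (m : ∀ σ : Simplex Q n, M.obj (op (p.obj (init σ)))) :
    obj p n ⟶ M where
  app X := ModuleCat.ofHom (Finsupp.linearCombination ℤ fun b : Basis p n X.unop =>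
    (M.map b.hom.op).hom (m b.simplex))
  naturality X Y f := by
    refine ModuleCat.hom_ext (Finsupp.lhom_ext' fun b => LinearMap.ext_ring ?_)
    refine (congrArg (Finsupp.linearCombination ℤ fun b : Basis p n Y.unop =>
      (M.map b.hom.op).hom (m b.simplex))
      (Finsupp.mapDomain_single (f := Basis.precomp f.unop))).trans ?_
    refine (linearCombination_single_one ..).trans ?_
    refine Eq.trans ?_ (congrArg (M.map f).hom (linearCombination_single_one ..)).symm
    simp only [Basis.precomp, op_comp, Functor.map_comp]
    rfl

theorem eval_ofValues {n : ℕ} (m : ∀ σ : Simplex Q n, M.obj (op (p.obj (init σ))))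
    (σ : Simplex Q n) : eval (ofValues m) σ = m σ := by
  refine (linearCombination_single_one ..).trans ?_
  simp

theorem eval_d_comp {n : ℕ} (f : obj p n ⟶ M) (σ : Simplex Q (n + 1)) :
    eval (d p n ≫ f) σ = ∑ i : Fin (n + 2), (-1 : ℤ) ^ (i : ℕ) •
      (M.map (p.map (homOfLE (le_face σ i))).op).hom (eval f (σ.face i)) := by
  refine (congrArg (component f (p.obj (init σ))) (bdry_single _)).trans ?_
  rw [map_sum]
  refine Finset.sum_congr rfl fun i _ => ?_
  rw [map_zsmul, component_single]
  simp only [Basis.face, Category.id_comp]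
  rfl

instance projective_obj (n : ℕ) : Projective (obj p n) where
  factors {E X} f e he := by
    have he' := fun Y => (NatTrans.epi_iff_epi_app e).1 he Y
    choose m hm using fun σ : Simplex Q n =>
      (ModuleCat.epi_iff_surjective _).1 (he' (op (p.obj (init σ)))) (eval f σ)
    refine ⟨ofValues m, hom_ext fun σ => ?_⟩
    rw [← hm, ← eval_ofValues m]
    rfl

end OrderBar

/-! ### Exactness of cochain complexes with coefficients -/

namespace IntCochain

variable {X Y Z : Type*} [Fintype X] [DecidableEq X] [Fintype Y] [DecidableEq Y]
  (A : Type*) [AddCommGroup A]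

/-- The map on functions with values in `A` given by the matrix of a map on integral functions. -/
def extend (L : (X → ℤ) →ₗ[ℤ] (Y → ℤ)) (f : X → A) (y : Y) : A :=
  ∑ x, L (Pi.single x 1) y • f x

omit [Fintype Y] [DecidableEq Y] in
theorem apply_eq_sum (L : (X → ℤ) →ₗ[ℤ] (Y → ℤ)) (f : X → ℤ) (y : Y) :
    L f y = ∑ x, L (Pi.single x 1) y * f x := by
  conv_lhs => rw [← Finset.univ_sum_single f, map_sum, Finset.sum_apply]
  refine Finset.sum_congr rfl fun x _ => ?_
  have : (Pi.single x (f x) : X → ℤ) = f x • Pi.single x 1 := by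
    rw [← Pi.single_smul, smul_eq_mul, mul_one]
  rw [this, map_smul, Pi.smul_apply, smul_eq_mul, mul_comm]

theorem extend_comp (L : (Y → ℤ) →ₗ[ℤ] (Z → ℤ)) (L' : (X → ℤ) →ₗ[ℤ] (Y → ℤ)) (f : X → A) :
    extend A (L ∘ₗ L') f = extend A L (extend A L' f) := by
  funext z
  simp only [extend, LinearMap.comp_apply, Finset.smul_sum, smul_smul]
  rw [Finset.sum_comm]
  refine Finset.sum_congr rfl fun x _ => ?_
  rw [apply_eq_sum L, Finset.sum_smul]

omit [Fintype Y] [DecidableEq Y] in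
theorem extend_add (L L' : (X → ℤ) →ₗ[ℤ] (Y → ℤ)) (f : X → A) :
    extend A (L + L') f = extend A L f + extend A L' f := by
  funext y
  simp [extend, add_smul, Finset.sum_add_distrib]

theorem extend_id (f : X → A) : extend A LinearMap.id f = f := by
  funext x
  simp [extend, Pi.single_apply, ite_smul]

variable {A}

variable {S : ℕ → Type*} [∀ n, Fintype (S n)] [∀ n, DecidableEq (S n)]
  (δ : ∀ n, (S n → ℤ) →ₗ[ℤ] (S (n + 1) → ℤ))

/-- A bounded cochain complex of finitely generated free groups which is exact from degree `d` on
is contractible there. -/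
theorem exists_contraction (hδ : ∀ n x, δ (n + 1) (δ n x) = 0) (N : ℕ)
    (hN : ∀ n, N ≤ n → IsEmpty (S n)) (d : ℕ)
    (hex : ∀ n, d ≤ n → ∀ x, δ (n + 1) x = 0 → ∃ y, δ n y = x) (n : ℕ) (hn : d ≤ n) :
    ∃ (s : (S (n + 1) → ℤ) →ₗ[ℤ] (S n → ℤ)) (s' : (S (n + 2) → ℤ) →ₗ[ℤ] (S (n + 1) → ℤ)),
      δ n ∘ₗ s + s' ∘ₗ δ (n + 1) = LinearMap.id := by
  -- Downward induction on the degree, starting where the complex vanishes.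
  induction hk : N - n generalizing n with
  | zero =>
    have := hN (n + 1) (by omega)
    exact ⟨0, 0, LinearMap.ext fun x => Subsingleton.elim _ _⟩
  | succ k ih =>
    obtain ⟨s₁, s₂, hs⟩ := ih (n + 1) (by omega) (by omega)
    -- The contraction one degree higher corrects each basis vector to a cocycle. Exactness lifts
    -- these, and freeness assembles the lifts into a linear map.
    have hlift : ∀ x : S (n + 1), ∃ y, δ n y = Pi.single x 1 - s₁ (δ (n + 1) (Pi.single x 1)) := by
      intro x
      refine hex n hn _ ?_
      have := LinearMap.congr_fun hs (δ (n + 1) (Pi.single x 1))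
      simp only [LinearMap.add_apply, LinearMap.comp_apply, hδ, map_zero, add_zero,
        LinearMap.id_apply] at this
      rw [map_sub, this, sub_self]
    choose y hy using hlift
    refine ⟨(Pi.basisFun ℤ (S (n + 1))).constr ℤ y, s₁, (Pi.basisFun ℤ (S (n + 1))).ext fun x => ?_⟩
    rw [LinearMap.add_apply, LinearMap.comp_apply, Module.Basis.constr_basis, hy]
    simp

theorem exact_extend (hδ : ∀ n x, δ (n + 1) (δ n x) = 0) (N : ℕ)
    (hN : ∀ n, N ≤ n → IsEmpty (S n)) (d : ℕ)
    (hex : ∀ n, d ≤ n → ∀ x, δ (n + 1) x = 0 → ∃ y, δ n y = x) (n : ℕ) (hn : d ≤ n)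
    (f : S (n + 1) → A) (hf : extend A (δ (n + 1)) f = 0) : ∃ g, extend A (δ n) g = f := by
  obtain ⟨s, s', hs⟩ := exists_contraction δ hδ N hN d hex n hn
  refine ⟨extend A s f, ?_⟩
  have := congrArg (fun L => extend A L f) hs
  simp only [extend_add, extend_comp, extend_id, hf] at this
  have h0 : extend A s' (0 : S (n + 2) → A) = 0 := by
    funext x
    simp [extend]
  rw [h0, add_zero] at this
  exact this

end IntCochain

/-! ### Cochains on the simplices with a given initial vertex -/

namespace OrderBar

variable {Q : Type u} [PartialOrder Q]

/-- The simplices with initial vertex `U`. -/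
abbrev Star (U : Q) (n : ℕ) : Type u := {σ : Simplex Q n // init σ = U}

theorem init_face_succ {n : ℕ} (σ : Simplex Q (n + 1)) (i : Fin (n + 1)) :
    init (σ.face i.succ) = init σ := by
  simp [init, OrderSimplex.face]

theorem lt_init_face_zero {n : ℕ} (σ : Simplex Q (n + 1)) : init σ < init (σ.face 0) :=
  σ.2.1 (by simp)

/-- The faces opposite to the vertices other than the initial one. -/
def Star.face {U : Q} {n : ℕ} (σ : Star U (n + 1)) (i : Fin (n + 1)) : Star U n :=
  ⟨σ.1.face i.succ, (init_face_succ _ _).trans σ.2⟩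

instance finite_simplex [Finite Q] (n : ℕ) : Finite (Simplex Q n) := Subtype.finite

theorem isEmpty_simplex [Finite Q] (n : ℕ) (hn : Nat.card Q ≤ n) : IsEmpty (Simplex Q n) := by
  refine ⟨fun σ => ?_⟩
  have := Nat.card_le_card_of_injective σ.1 σ.2.1.injective
  simp at this
  omega

/-- The coboundary of a cochain on the simplices with initial vertex `U`. -/
def starCoboundary {A : Type*} [AddCommGroup A] {U : Q} {n : ℕ} (f : Star U n → A)
    (σ : Star U (n + 1)) : A :=
  ∑ i : Fin (n + 1), (-1 : ℤ) ^ ((i : ℕ) + 1) • f (σ.face i)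

/-- The complex of integral cochains on the simplices with initial vertex `U` is exact in the
degrees larger than `d`. -/
def StarExact (U : Q) (d : ℕ) : Prop :=
  ∀ n, d ≤ n → ∀ f : Star U (n + 1) → ℤ, starCoboundary f = 0 →
    ∃ g : Star U n → ℤ, starCoboundary g = f

/-- A simplex of a subposet, considered as a simplex of the whole poset. -/
def toSimplex {B : Set Q} {n : ℕ} (σ : OrderSimplex B n) : Simplex Q n :=
  ⟨σ.1, σ.2.1, fun _ => trivial⟩

/-- Omitting the initial vertex moves it strictly up, where `F` vanishes; every other face still
starts at `U`. -/
theorem simplicialCoboundary_eq_starCoboundary {B : Set Q} {U : Q} {n : ℕ}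
    (F : OrderSimplex B n → ℤ) (f : Star U n → ℤ)
    (hF : ∀ τ : OrderSimplex B n, U < init (toSimplex τ) → F τ = 0)
    (hf : ∀ (τ : OrderSimplex B n) (h : init (toSimplex τ) = U), F τ = f ⟨toSimplex τ, h⟩)
    (σ : OrderSimplex B (n + 1)) (hσ : init (toSimplex σ) = U) :
    simplicialCoboundary B n F σ = starCoboundary f ⟨toSimplex σ, hσ⟩ := by
  change ∑ i : Fin (n + 2), (-1 : ℤ) ^ (i : ℕ) * F (σ.face i) = _
  rw [Fin.sum_univ_succ, hF (σ.face 0) (hσ.symm.trans_lt (lt_init_face_zero (toSimplex σ))),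
    mul_zero, zero_add]
  refine Finset.sum_congr rfl fun i _ => ?_
  rw [hf (σ.face i.succ) ((init_face_succ (toSimplex σ) i).trans hσ)]
  rfl

theorem simplicialCoboundary_eq_zero {B : Set Q} {U : Q} {n : ℕ} (F : OrderSimplex B n → ℤ)
    (hF : ∀ τ : OrderSimplex B n, U < init (toSimplex τ) → F τ = 0)
    (σ : OrderSimplex B (n + 1)) (hσ : U < init (toSimplex σ)) :
    simplicialCoboundary B n F σ = 0 := by
  change ∑ i : Fin (n + 2), (-1 : ℤ) ^ (i : ℕ) * F (σ.face i) = 0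
  refine Finset.sum_eq_zero fun i _ => ?_
  rw [hF (σ.face i) (hσ.trans_le (le_face (toSimplex σ) i)), mul_zero]

theorem starCoboundary_starCoboundary {U : Q} {n : ℕ} (f : Star U n → ℤ) :
    starCoboundary (starCoboundary f) = 0 := by
  classical
  funext σ
  let F : Simplex Q n → ℤ := fun τ => if h : init τ = U then f ⟨τ, h⟩ else 0
  have hF : ∀ τ : Simplex Q n, U < init τ → F τ = 0 := fun τ h => dif_neg h.ne'
  have hf : ∀ (τ : Simplex Q n) (h : init τ = U), F τ = f ⟨τ, h⟩ := fun τ h => dif_pos h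
  have h := congrFun (simplicialCoboundary_comp Set.univ n F) σ.1
  rw [simplicialCoboundary_eq_starCoboundary (simplicialCoboundary Set.univ n F)
    (starCoboundary f) (simplicialCoboundary_eq_zero F hF)
    (simplicialCoboundary_eq_starCoboundary F f hF hf) σ.1 σ.2] at h
  exact h

theorem StarExact.exact [Finite Q] {U : Q} {d : ℕ} (h : StarExact U d) {A : Type*} [AddCommGroup A]
    (n : ℕ) (hn : d ≤ n) (f : Star U (n + 1) → A) (hf : starCoboundary f = 0) :
    ∃ g : Star U n → A, starCoboundary g = f := by
  classical
  have := fun n => Fintype.ofFinite (Star U n)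
  let δ : ∀ n, (Star U n → ℤ) →ₗ[ℤ] (Star U (n + 1) → ℤ) := fun n =>
    { toFun := starCoboundary
      map_add' := fun f g => by
        funext σ
        simp [starCoboundary, mul_add, Finset.sum_add_distrib]
      map_smul' := fun c f => by
        funext σ
        simp only [starCoboundary, Pi.smul_apply, RingHom.id_apply, Finset.smul_sum]
        exact Finset.sum_congr rfl fun i _ => smul_comm _ _ _ }
  have hδ : ∀ n (f : Star U n → A), IntCochain.extend A (δ n) f = starCoboundary f := by
    intro n f
    funext σ
    simp only [IntCochain.extend, δ, LinearMap.coe_mk, AddHom.coe_mk, starCoboundary,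
      Finset.sum_smul]
    rw [Finset.sum_comm]
    refine Finset.sum_congr rfl fun i _ => ?_
    rw [Finset.sum_eq_single (σ.face i)]
    · simp
    · intro τ _ hτ
      simp [Pi.single_eq_of_ne hτ.symm]
    · simp
  obtain ⟨g, hg⟩ := IntCochain.exact_extend δ (fun n x => starCoboundary_starCoboundary x)
    (Nat.card Q) (fun n hn => by
      have := isEmpty_simplex (Q := Q) n hn
      infer_instance) d h n hn f ((hδ _ f).trans hf)
  exact ⟨g, (hδ _ g).symm.trans hg⟩

/-- Exactness of the cochains on the stars of all vertices implies exactness of the cochains with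
values in a coefficient system. -/
theorem exists_coboundary_eq [Finite Q] {N : Q → Type*} [∀ J, AddCommGroup (N J)]
    (res : ∀ {J T : Q}, J ≤ T → N T →+ N J) (res_self : ∀ J (x : N J), res (le_refl J) x = x)
    (res_res : ∀ {J T V : Q} (h : J ≤ T) (h' : T ≤ V) (x : N V),
      res h (res h' x) = res (h.trans h') x)
    {d : ℕ} (hd : ∀ U : Q, StarExact U d) (n : ℕ) (hn : d ≤ n)
    (m : ∀ σ : Simplex Q (n + 1), N (init σ))
    (hm : ∀ σ : Simplex Q (n + 2),
      ∑ i : Fin (n + 3), (-1 : ℤ) ^ (i : ℕ) • res (le_face σ i) (m (σ.face i)) = 0) :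
    ∃ g : ∀ σ : Simplex Q n, N (init σ), ∀ σ : Simplex Q (n + 1),
      ∑ i : Fin (n + 2), (-1 : ℤ) ^ (i : ℕ) • res (le_face σ i) (g (σ.face i)) = m σ := by
  classical
  have := Fintype.ofFinite Q
  -- The cocycle is killed one initial vertex at a time, from the top down: `T` is the upper set of
  -- initial vertices at which it already vanishes.
  have key : ∀ (k : ℕ) (T : Finset Q) (_ : Tᶜ.card = k) (_ : ∀ U ∈ T, ∀ V, U ≤ V → V ∈ T)
      (m : ∀ σ : Simplex Q (n + 1), N (init σ)) (_ : ∀ σ, init σ ∈ T → m σ = 0)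
      (_ : ∀ σ : Simplex Q (n + 2),
        ∑ i : Fin (n + 3), (-1 : ℤ) ^ (i : ℕ) • res (le_face σ i) (m (σ.face i)) = 0),
      ∃ g : ∀ σ : Simplex Q n, N (init σ), ∀ σ : Simplex Q (n + 1),
        ∑ i : Fin (n + 2), (-1 : ℤ) ^ (i : ℕ) • res (le_face σ i) (g (σ.face i)) = m σ := by
    intro k
    induction k with
    | zero =>
      intro T hT _ m hmT _
      have hT' : ∀ x, x ∈ T := by simpa [Finset.card_eq_zero, Finset.eq_univ_iff_forall] using hT
      refine ⟨fun _ => 0, fun σ => ?_⟩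
      rw [hmT σ (hT' _)]
      simp
    | succ k ih =>
      intro T hT hup m hmT hm
      obtain ⟨U, hU⟩ := Tᶜ.exists_maximal (Finset.card_pos.1 (by omega))
      have hUT : U ∉ T := Finset.mem_compl.1 hU.1
      have hUmax : ∀ V, U < V → V ∈ T := by
        intro V hV
        by_contra h
        exact hV.not_ge (hU.2 (Finset.mem_compl.2 h) hV.le)
      -- Here `res` only transports along `init σ = U`. By maximality of `U` in the complement, the
      -- face omitting `U` starts in `T`, so `f` is a cocycle of the star.
      let f : Star U (n + 1) → N U := fun σ => res σ.2.ge (m σ.1)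
      have hf : starCoboundary f = 0 := by
        funext σ
        have h := congrArg (res σ.2.ge) (hm σ.1)
        rw [Fin.sum_univ_succ, hmT (σ.1.face 0) (hUmax _ (σ.2.symm.trans_lt
          (lt_init_face_zero σ.1))), map_zero, smul_zero, zero_add, map_sum, map_zero] at h
        refine Eq.trans (Finset.sum_congr rfl fun i _ => ?_) h
        rw [map_zsmul, res_res]
        rfl
      obtain ⟨g, hg⟩ := (hd U).exact n hn f hf
      -- Extension by zero: the coboundary of `G` corrects `m` at `U` and is zero at `T`, since no
      -- face of a simplex starting in the upper set `T` starts at `U`.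
      let G : ∀ σ : Simplex Q n, N (init σ) := fun σ =>
        if h : init σ = U then res h.le (g ⟨σ, h⟩) else 0
      let m' : ∀ σ : Simplex Q (n + 1), N (init σ) := fun σ => m σ -
        ∑ i : Fin (n + 2), (-1 : ℤ) ^ (i : ℕ) • res (le_face σ i) (G (σ.face i))
      have hm'T : ∀ σ, init σ ∈ insert U T → m' σ = 0 := by
        intro σ hσ
        rcases Finset.mem_insert.1 hσ with hσ | hσ
        · have hinj : Function.Injective (res hσ.ge) := by
            refine Function.LeftInverse.injective (g := res hσ.le) fun x => ?_
            rw [res_res, res_self]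
          apply hinj
          have hfg := congrFun hg ⟨σ, hσ⟩
          simp only [m', map_sub, map_zero, map_sum]
          rw [sub_eq_zero, Fin.sum_univ_succ]
          have h0 : G (σ.face 0) = 0 := dif_neg (hσ ▸ lt_init_face_zero σ).ne'
          rw [h0, map_zero, smul_zero, map_zero, zero_add]
          refine hfg.symm.trans (Finset.sum_congr rfl fun i _ => ?_)
          have hi : init (σ.face i.succ) = U := (init_face_succ σ i).trans hσ
          rw [map_zsmul, res_res]
          simp only [G, dif_pos hi]
          rw [res_res, res_self]
          rfl
        · simp only [m']
          rw [hmT σ hσ, zero_sub, neg_eq_zero]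
          refine Finset.sum_eq_zero fun i _ => ?_
          have : init (σ.face i) ≠ U := fun h => hUT (h ▸ hup _ hσ _ (le_face σ i))
          simp only [G, dif_neg this, map_zero, smul_zero]
      have hdd : ∀ σ : Simplex Q (n + 2), ∑ i : Fin (n + 3), (-1 : ℤ) ^ (i : ℕ) •
          res (le_face σ i) (m' (σ.face i)) = 0 := by
        intro σ
        simp only [m', map_sub, smul_sub, Finset.sum_sub_distrib, hm σ, zero_sub, neg_eq_zero]
        let F : Simplex Q n → N (init σ) := fun τ =>
          if h : init σ ≤ init τ then res h (G τ) else 0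
        refine Eq.trans (Finset.sum_congr rfl fun i _ => ?_) (sum_face_face F σ)
        rw [map_sum]
        refine congrArg _ (Finset.sum_congr rfl fun j _ => ?_)
        rw [map_zsmul, res_res]
        have hle := (le_face σ i).trans (le_face (σ.face i) j)
        have hF : F ((σ.face i).face j) = res hle (G ((σ.face i).face j)) := dif_pos hle
        rw [hF]
      obtain ⟨g', hg'⟩ := ih (insert U T) (by
          rw [Finset.compl_insert, Finset.card_erase_of_mem hU.1]
          omega) (by
          intro V hV W hVW
          rw [Finset.mem_insert] at hV ⊢
          rcases hV with rfl | hV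
          · rcases hVW.eq_or_lt with rfl | h
            · exact Or.inl rfl
            · exact Or.inr (hUmax _ h)
          · exact Or.inr (hup V hV W hVW)) m' hm'T hdd
      refine ⟨fun σ => g' σ + G σ, fun σ => ?_⟩
      simp only [map_add, smul_add, Finset.sum_add_distrib]
      rw [hg' σ]
      simp [m']
  exact key _ ∅ rfl (by simp) m (by simp) hm

end OrderBar

/-! ### Relative cohomology and exactness -/

section RelCohomology

open CategoryTheory

variable {Q : Type u} [PartialOrder Q]

theorem relCochainComplex_d (A B : Set Q) (n : ℕ) :
    (relCochainComplex A B).d n (n + 1) = ModuleCat.ofHom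
      ((simplicialCoboundary A n).restrict (simplicialCoboundary_mem A B n)) := by
  simp only [relCochainComplex]
  exact CochainComplex.of_d ..

/-- The predecessor degree `i` is kept general so that degree `0`, whose predecessor is `0` itself
with zero differential, is covered. -/
theorem not_nontrivial_relCohomology_iff (A B : Set Q) (n i : ℕ)
    (hi : (ComplexShape.up ℕ).prev n = i) :
    ¬ Nontrivial (relCohomology A B n) ↔ ∀ x, ((relCochainComplex A B).d n (n + 1)).hom x = 0 →
      ∃ y, ((relCochainComplex A B).d i n).hom y = x := by
  rw [not_nontrivial_iff_subsingleton]
  have h1 : Subsingleton (relCohomology A B n) ↔ (relCochainComplex A B).ExactAt n := by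
    rw [HomologicalComplex.exactAt_iff_isZero_homology]
    exact ⟨fun h => @ModuleCat.isZero_of_subsingleton _ _ (relCohomology A B n) h,
      fun h => ModuleCat.subsingleton_of_isZero h⟩
  rw [h1, HomologicalComplex.exactAt_iff' _ i n (n + 1) hi (by simp),
    ShortComplex.moduleCat_exact_iff]
  rfl

theorem not_nontrivial_relCohomology_succ_iff (A B : Set Q) (n : ℕ) :
    ¬ Nontrivial (relCohomology A B (n + 1)) ↔ ∀ f ∈ relCochains A B (n + 1),
      simplicialCoboundary A (n + 1) f = 0 →
        ∃ g ∈ relCochains A B n, simplicialCoboundary A n g = f := by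
  rw [not_nontrivial_relCohomology_iff A B (n + 1) n (by simp), relCochainComplex_d,
    relCochainComplex_d]
  constructor
  · intro h f hf hf0
    obtain ⟨g, hg⟩ := h (⟨f, hf⟩ : relCochains A B (n + 1)) (Subtype.ext hf0)
    exact ⟨g.1, g.2, congrArg Subtype.val hg⟩
  · intro h x hx
    obtain ⟨g, hg, hgx⟩ := h x.1 x.2 (congrArg Subtype.val hx)
    exact ⟨(⟨g, hg⟩ : relCochains A B n), Subtype.ext hgx⟩

theorem nontrivial_relCohomology_zero (A B : Set Q) (f : OrderSimplex A 0 → ℤ)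
    (hf : f ∈ relCochains A B 0) (hf0 : simplicialCoboundary A 0 f = 0) (hne : f ≠ 0) :
    Nontrivial (relCohomology A B 0) := by
  by_contra h
  rw [not_nontrivial_relCohomology_iff A B 0 0 CochainComplex.prev_nat_zero,
    relCochainComplex_d] at h
  obtain ⟨y, hy⟩ := h (⟨f, hf⟩ : relCochains A B 0) (Subtype.ext hf0)
  rw [(relCochainComplex A B).shape 0 0 (by simp)] at hy
  exact hne (congrArg Subtype.val hy).symm

theorem not_nontrivial_relCohomology_of_card_le [Finite Q] (A B : Set Q) (n : ℕ)
    (hn : Nat.card Q ≤ n + 1) : ¬ Nontrivial (relCohomology A B (n + 1)) := by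
  rw [not_nontrivial_relCohomology_succ_iff]
  intro f _ _
  have := OrderBar.isEmpty_simplex (Q := Q) (n + 1) hn
  have : IsEmpty (OrderSimplex A (n + 1)) := ⟨fun σ => isEmptyElim (OrderBar.toSimplex σ)⟩
  exact ⟨0, Submodule.zero_mem _, Subsingleton.elim _ _⟩

end RelCohomology

/-! ### Relative cochains as cochains on stars -/

namespace OrderBar

variable {Q : Type u} [PartialOrder Q] {Ω : Set Q}

theorem not_lt_of_mem_upperSubposet (hΩ : IsAntichain (· ≤ ·) Ω) {U V : Q} (hU : U ∈ Ω)
    (hV : V ∈ upperSubposet Ω) : ¬ V < U := by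
  obtain ⟨W, hW, hWV⟩ := hV
  intro h
  exact hΩ hW hU (hWV.trans_lt h).ne (hWV.trans_lt h).le

theorem notMem_strictUpperSubposet (hΩ : IsAntichain (· ≤ ·) Ω) {U : Q} (hU : U ∈ Ω) :
    U ∉ strictUpperSubposet Ω := by
  rintro ⟨W, hW, h⟩
  exact hΩ hW hU h.ne h.le

theorem mem_strictUpperSubposet_of_notMem {V : Q} (hV : V ∈ upperSubposet Ω) (hV' : V ∉ Ω) :
    V ∈ strictUpperSubposet Ω := by
  obtain ⟨W, hW, h⟩ := hV
  refine ⟨W, hW, lt_of_le_of_ne h ?_⟩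
  rintro rfl
  exact hV' hW

/-- A simplex with initial vertex in `Ω` is a simplex of the subposet above `Ω`. -/
def ofSimplex {n : ℕ} (σ : Simplex Q n) (h : init σ ∈ Ω) : OrderSimplex (upperSubposet Ω) n :=
  ⟨σ.1, σ.2.1, fun i => ⟨init σ, h, σ.2.1.monotone (Fin.zero_le i)⟩⟩

theorem relCochain_eq_zero {n : ℕ} {g : OrderSimplex (upperSubposet Ω) n → ℤ}
    (hg : g ∈ relCochains (upperSubposet Ω) (strictUpperSubposet Ω) n)
    (τ : OrderSimplex (upperSubposet Ω) n) {U : Q} (hU : U ∈ Ω) (h : U < init (toSimplex τ)) :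
    g τ = 0 :=
  hg τ fun i => ⟨U, hU, h.trans_le (τ.2.1.monotone (Fin.zero_le i))⟩

/-- Cochains on the star of `U` form a direct factor of the relative cochains: they extend by zero,
and since `U` is minimal above the antichain `Ω`, a simplex with a face starting at `U` starts at
`U` itself. -/
theorem starExact_of_relCohomology (hΩ : IsAntichain (· ≤ ·) Ω) {U : Q} (hU : U ∈ Ω) (d : ℕ)
    (h : ∀ n, d ≤ n →
      ¬ Nontrivial (relCohomology (upperSubposet Ω) (strictUpperSubposet Ω) (n + 1))) :
    StarExact U d := by
  classical
  intro n hn f hf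
  let F : OrderSimplex (upperSubposet Ω) (n + 1) → ℤ := fun τ =>
    if h : init (toSimplex τ) = U then f ⟨toSimplex τ, h⟩ else 0
  have hF : F ∈ relCochains (upperSubposet Ω) (strictUpperSubposet Ω) (n + 1) := by
    intro τ hτ
    refine dif_neg fun h => notMem_strictUpperSubposet hΩ hU ?_
    rw [← h]
    exact hτ 0
  have hF0 : simplicialCoboundary _ (n + 1) F = 0 := by
    funext σ
    by_cases hσ : init (toSimplex σ) = U
    · rw [simplicialCoboundary_eq_starCoboundary F f (fun τ h => dif_neg h.ne')
        (fun τ h => dif_pos h) σ hσ, hf]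
      rfl
    · change ∑ i : Fin (n + 3), (-1 : ℤ) ^ (i : ℕ) * F (σ.face i) = 0
      refine Finset.sum_eq_zero fun i _ => ?_
      have : init (toSimplex (σ.face i)) ≠ U := by
        intro h
        have h1 : init (toSimplex σ) ≤ U := (le_face (toSimplex σ) i).trans_eq h
        exact not_lt_of_mem_upperSubposet hΩ hU (σ.2.2 0) (lt_of_le_of_ne h1 hσ)
      rw [show F (σ.face i) = 0 from dif_neg this, mul_zero]
  obtain ⟨g, hg, hgF⟩ := (not_nontrivial_relCohomology_succ_iff _ _ n).1 (h n hn) F hF hF0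
  refine ⟨fun σ => g (ofSimplex σ.1 (σ.2.symm ▸ hU)), funext fun σ => ?_⟩
  have hσ : init σ.1 ∈ Ω := σ.2.symm ▸ hU
  refine (simplicialCoboundary_eq_starCoboundary g _ (fun τ h => relCochain_eq_zero hg τ hU h)
    (fun τ h => rfl) (ofSimplex σ.1 hσ) σ.2).symm.trans ?_
  rw [hgF]
  exact dif_pos σ.2

/-- The vertex `U` is both maximal and minimal above `Ω`, hence an isolated point outside the
smaller subcomplex; its indicator function is a nonzero cocycle. -/
theorem nontrivial_relCohomology_zero_of_isMax (hΩ : IsAntichain (· ≤ ·) Ω) {U : Q} (hU : U ∈ Ω)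
    (hmax : IsMax U) :
    Nontrivial (relCohomology (upperSubposet Ω) (strictUpperSubposet Ω) 0) := by
  classical
  refine nontrivial_relCohomology_zero _ _ (fun τ => if init (toSimplex τ) = U then 1 else 0)
    ?_ ?_ ?_
  · intro τ hτ
    refine if_neg fun h => notMem_strictUpperSubposet hΩ hU ?_
    rw [← h]
    exact hτ 0
  · funext σ
    change ∑ i : Fin 2, (-1 : ℤ) ^ (i : ℕ) *
      (if init (toSimplex (σ.face i)) = U then 1 else 0) = 0
    refine Finset.sum_eq_zero fun i _ => ?_
    have h01 : σ.1 0 < σ.1 1 := σ.2.1 (by simp)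
    have : init (toSimplex (σ.face i)) ≠ U := by
      intro h
      rcases (le_face (toSimplex σ) i).eq_or_lt with h' | h'
      · have h2 : σ.1 0 = U := h'.trans h
        exact (h2 ▸ hmax).not_lt h01
      · exact not_lt_of_mem_upperSubposet hΩ hU (σ.2.2 0) (h ▸ h')
    rw [if_neg this, mul_zero]
  · intro h
    have := congrFun h ⟨fun _ => U, fun i j hij => by omega, fun _ => ⟨U, hU, le_rfl⟩⟩
    have h1 : (1 : ℤ) = 0 := (if_pos rfl).symm.trans this
    omega

end OrderBar

/-! ### Cochains of the bar complex as coefficient systems -/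

namespace OrderBar

open CategoryTheory Opposite

variable {Q : Type u} [PartialOrder Q] {𝒞 : Type (max u v)} [SmallCategory 𝒞] {p : Q ⥤ 𝒞}
  {M : 𝒞ᵒᵖ ⥤ ModuleCat.{max u v} ℤ}

/-- The restriction maps of the coefficient system on the poset induced by a contravariant
functor. -/
noncomputable def res {J T : Q} (h : J ≤ T) : M.obj (op (p.obj T)) →+ M.obj (op (p.obj J)) :=
  (M.map (p.map (homOfLE h)).op).hom.toAddMonoidHom

theorem res_self (J : Q) (x : M.obj (op (p.obj J))) : res (le_refl J) x = x := by
  change (M.map (p.map (𝟙 J)).op).hom x = x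
  simp

theorem res_res {J T V : Q} (h : J ≤ T) (h' : T ≤ V) (x : M.obj (op (p.obj V))) :
    res h (res h' x) = res (h.trans h') x := by
  change (M.map (p.map (homOfLE h)).op).hom ((M.map (p.map (homOfLE h')).op).hom x) =
    (M.map (p.map (homOfLE h ≫ homOfLE h')).op).hom x
  rw [p.map_comp, op_comp, M.map_comp]
  rfl

theorem eval_d_comp_eq_sum_res {n : ℕ} (f : obj p n ⟶ M) (σ : Simplex Q (n + 1)) :
    eval (d p n ≫ f) σ =
      ∑ i : Fin (n + 2), (-1 : ℤ) ^ (i : ℕ) • res (le_face σ i) (eval f (σ.face i)) :=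
  eval_d_comp f σ

/-- This removes the orbit category from the computation: only the values of `M` along the poset
matter. -/
theorem cocyclesBound_iff (n : ℕ) : CocyclesBound (complex p) n M ↔
    ∀ m : ∀ σ : Simplex Q (n + 1), M.obj (op (p.obj (init σ))),
      (∀ σ : Simplex Q (n + 2),
        ∑ i : Fin (n + 3), (-1 : ℤ) ^ (i : ℕ) • res (le_face σ i) (m (σ.face i)) = 0) →
      ∃ g : ∀ σ : Simplex Q n, M.obj (op (p.obj (init σ))), ∀ σ : Simplex Q (n + 1),
        ∑ i : Fin (n + 2), (-1 : ℤ) ^ (i : ℕ) • res (le_face σ i) (g (σ.face i)) = m σ := by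
  unfold CocyclesBound
  rw [complex_d, complex_d]
  constructor
  · intro h m hm
    obtain ⟨g, hg⟩ := h (ofValues m) (hom_ext fun σ => by
      refine (eval_d_comp_eq_sum_res (ofValues m) σ).trans ?_
      simp only [eval_ofValues]
      exact hm σ)
    refine ⟨eval g, fun σ => ?_⟩
    refine (eval_d_comp_eq_sum_res g σ).symm.trans ?_
    exact (congrArg (fun f => eval f σ) hg).trans (eval_ofValues m σ)
  · intro h f hf
    obtain ⟨g, hg⟩ := h (eval f) fun σ => by
      refine (eval_d_comp_eq_sum_res f σ).symm.trans ?_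
      exact congrArg (fun f => eval f σ) hf
    refine ⟨ofValues g, hom_ext fun σ => ?_⟩
    refine (eval_d_comp_eq_sum_res (ofValues g) σ).trans ?_
    simp only [eval_ofValues]
    exact hg σ

theorem cocyclesBound_of_starExact [Finite Q] {d : ℕ} (hd : ∀ U : Q, StarExact U d) :
    CocyclesBound (complex p) d M :=
  (cocyclesBound_iff d).2 fun m hm =>
    exists_coboundary_eq (N := fun J => M.obj (op (p.obj J))) res res_self res_res hd d le_rfl m hm

theorem complex_d_app (n : ℕ) (X : 𝒞ᵒᵖ) (x : Basis p (n + 1) X.unop →₀ ℤ) :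
    (((complex p).d (n + 1) n).app X).hom x = bdry n X.unop x := by
  rw [complex_d]
  rfl

/-- A bar complex of free modules which is objectwise acyclic is a projective resolution. -/
theorem isProjectiveResolution {Z : 𝒞ᵒᵖ ⥤ ModuleCat.{max u v} ℤ} (ε : obj p 0 ⟶ Z)
    (hε : ∀ X, Function.Surjective (component ε X))
    (h₀ : ∀ (X : 𝒞) (x : Basis p 1 X →₀ ℤ), component ε X (bdry 0 X x) = 0)
    (h₁ : ∀ (X : 𝒞) (x : Basis p 0 X →₀ ℤ), component ε X x = 0 → ∃ y, bdry 0 X y = x)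
    (h : ∀ (n : ℕ) (X : 𝒞) (x : Basis p (n + 1) X →₀ ℤ), bdry n X x = 0 →
      ∃ y, bdry (n + 1) X y = x) :
    IsProjectiveResolution (complex p) (Z := Z) ε := by
  have hexact : ∀ S : ShortComplex (𝒞ᵒᵖ ⥤ ModuleCat.{max u v} ℤ),
      (∀ X x, (S.g.app X).hom x = 0 → ∃ y, (S.f.app X).hom y = x) → S.Exact := by
    intro S hS
    rw [ShortComplex.exact_iff_isZero_homology]
    refine Functor.isZero _ fun X => ?_
    refine Limits.IsZero.of_iso ?_ (S.mapHomologyIso ((evaluation _ _).obj X)).symm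
    rw [← ShortComplex.exact_iff_isZero_homology, ShortComplex.moduleCat_exact_iff]
    exact hS X
  have hd : (complex p).d 1 0 ≫ ε = 0 := by
    rw [complex_d]
    refine NatTrans.ext (funext fun X => ModuleCat.hom_ext (LinearMap.ext fun x => ?_))
    exact h₀ X.unop x
  refine ⟨fun n => projective_obj n, hd, ?_, ?_, fun n => ?_⟩
  · exact (NatTrans.epi_iff_epi_app _).2 fun X =>
      (ModuleCat.epi_iff_surjective _).2 (hε X.unop)
  · refine hexact _ fun X x hx => ?_
    obtain ⟨y, hy⟩ := h₁ X.unop x hx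
    exact ⟨y, (complex_d_app 0 X y).trans hy⟩
  · refine hexact _ fun X x hx => ?_
    obtain ⟨y, hy⟩ := h n X.unop x ((complex_d_app n X x).symm.trans hx)
    exact ⟨y, (complex_d_app (n + 1) X y).trans hy⟩

end OrderBar

/-! ### Coefficients concentrated on the subgroups of a given order -/

/-- If the base coset goes to `gK`, then conjugation by `g⁻¹` embeds the first subgroup into the
second. -/
theorem OrbitCat.card_le_of_hom {G : Type u} [Group G] {X Y : OrbitCat G} (f : X ⟶ Y) :
    Nat.card X.subgroup ≤ Nat.card Y.subgroup := by
  have := Y.finite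
  let f' : (G ⧸ X.subgroup) →[G] (G ⧸ Y.subgroup) := f
  obtain ⟨g, hg⟩ := QuotientGroup.mk_surjective (f' (QuotientGroup.mk 1))
  have key : ∀ h ∈ X.subgroup, g⁻¹ * h * g ∈ Y.subgroup := by
    intro h hh
    have h1 : h • (QuotientGroup.mk 1 : G ⧸ X.subgroup) = QuotientGroup.mk 1 :=
      QuotientGroup.eq.2 (by simpa using hh)
    have h2 := f'.map_smul h (QuotientGroup.mk 1)
    rw [h1, ← hg] at h2
    have h3 := QuotientGroup.eq.1 h2
    simpa [mul_assoc] using h3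
  refine Nat.card_le_card_of_injective
    (fun h : X.subgroup => (⟨g⁻¹ * h * g, key h h.2⟩ : Y.subgroup)) fun a b hab => ?_
  simpa using hab

open CategoryTheory Opposite in
open scoped Classical in
/-- The module over the orbit category with value `ℤ` at the subgroups of order `k`, and `0`
elsewhere. -/
noncomputable def orderModule (G : Type u) [Group G] (k : ℕ) : OrbitModule G where
  -- Functions on a proposition: a copy of `ℤ` if it holds and `0` otherwise.
  obj X := ModuleCat.of ℤ (ULift.{u} (PLift (Nat.card X.unop.subgroup = k)) → ℤ)
  map {X Y} _ := ModuleCat.ofHom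
    { toFun := fun x _ => if h : Nat.card X.unop.subgroup = k then x ⟨⟨h⟩⟩ else 0
      map_add' := fun x y => by
        funext _
        by_cases h : Nat.card X.unop.subgroup = k <;> simp [h]
      map_smul' := fun c x => by
        funext _
        by_cases h : Nat.card X.unop.subgroup = k <;> simp [h] }
  map_id X := by
    refine ModuleCat.hom_ext (LinearMap.ext fun x => funext fun h => ?_)
    simp [h.down.down]
  map_comp {X Y Z} f g := by
    refine ModuleCat.hom_ext (LinearMap.ext fun x => funext fun h => ?_)
    -- Orders are monotone along morphisms, so a composite between subgroups of order `k` cannot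
    -- pass through another order.
    have h1 := OrbitCat.card_le_of_hom f.unop
    have h2 := OrbitCat.card_le_of_hom g.unop
    have h3 := h.down.down
    by_cases hX : Nat.card X.unop.subgroup = k
    · have hY : Nat.card Y.unop.subgroup = k := by omega
      simp [hX, hY]
    · simp [hX]

/-! ### Finite chains as strictly increasing sequences -/

namespace FinsetChain

open Finsupp

variable {P : Type*} [PartialOrder P]

open scoped Classical in
/-- The boundary of the set of values of a strictly increasing sequence. -/
theorem bdry_image {n : ℕ} {v : Fin (n + 1) → P} (hv : StrictMono v) :
    bdry (single (Finset.univ.image v) 1) =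
      ∑ i : Fin (n + 1), (-1 : ℤ) ^ (i : ℕ) • single (Finset.univ.image (v ∘ i.succAbove)) 1 := by
  rw [bdry_single, Finset.sum_image fun i _ j _ h => hv.injective h]
  refine Finset.sum_congr rfl fun i _ => ?_
  congr 2
  · rw [sgn]
    have : (Finset.univ.image v).filter (· < v i) = (Finset.univ.filter (· < i)).image v := by
      ext p
      simp only [Finset.mem_filter, Finset.mem_image, Finset.mem_univ, true_and]
      constructor
      · rintro ⟨⟨j, rfl⟩, hj⟩
        exact ⟨j, hv.lt_iff_lt.1 hj, rfl⟩
      · rintro ⟨j, hj, rfl⟩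
        exact ⟨⟨j, rfl⟩, hv hj⟩
    rw [this, Finset.card_image_of_injective _ hv.injective]
    have : Finset.univ.filter (· < i) = Finset.Iio i := by
      ext j
      simp
    rw [this, Fin.card_Iio]
  · ext p
    simp only [Finset.mem_erase, Finset.mem_image, Finset.mem_univ, true_and, Function.comp_apply]
    constructor
    · rintro ⟨hp, j, rfl⟩
      obtain ⟨k, hk⟩ := Fin.exists_succAbove_eq (x := j) (y := i) fun h => hp (h ▸ rfl)
      exact ⟨k, by rw [hk]⟩
    · rintro ⟨k, rfl⟩
      exact ⟨fun h => Fin.succAbove_ne i k (hv.injective h), _, rfl⟩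

/-- The boundary operator lowers the degree by one. -/
theorem filter_bdry (k : ℕ) (x : Finset P →₀ ℤ) :
    (bdry x).filter (fun s => s.card = k) = bdry (x.filter fun s => s.card = k + 1) := by
  classical
  induction x using Finsupp.induction_linear with
  | zero => rw [map_zero, filter_zero, filter_zero, map_zero]
  | add x y hx hy => simp only [map_add, filter_add, hx, hy]
  | single s c =>
    have : single s c = c • single s (1 : ℤ) := by simp
    rw [this, map_smul, filter_smul, filter_smul, map_smul, bdry_single, filter_sum]
    congr 1
    by_cases hs : s.card = k + 1
    · rw [filter_single_of_pos (fun s : Finset P => s.card = k + 1) hs, bdry_single]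
      refine Finset.sum_congr rfl fun a ha => ?_
      rw [filter_smul, filter_single_of_pos]
      rw [Finset.card_erase_of_mem ha, hs, Nat.add_sub_cancel]
    · rw [filter_single_of_neg (fun s : Finset P => s.card = k + 1) hs, map_zero]
      refine Finset.sum_eq_zero fun a ha => ?_
      rw [filter_smul, filter_single_of_neg, smul_zero]
      have := Finset.card_erase_add_one ha
      omega

/-- A finite chain is the set of values of a strictly increasing sequence. -/
theorem exists_strictMono {s : Finset P} (hs : IsChain (· ≤ ·) (s : Set P)) {n : ℕ}
    (hn : s.card = n) : ∃ v : Fin n → P, StrictMono v ∧ ∀ p, p ∈ s ↔ ∃ i, v i = p := by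
  classical
  let _ : LinearOrder s :=
    { (inferInstance : PartialOrder s) with
      le_total := fun a b => by
        by_cases h : a = b
        · exact Or.inl h.le
        · exact hs a.2 b.2 fun h' => h (Subtype.ext h')
      toDecidableLE := Classical.decRel _ }
  let e := monoEquivOfFin s (k := n) (by simpa using hn)
  refine ⟨fun i => (e i).1, fun i j hij => e.strictMono hij, fun p => ⟨fun hp => ?_, ?_⟩⟩
  · obtain ⟨i, hi⟩ := e.surjective ⟨p, hp⟩
    exact ⟨i, congrArg Subtype.val hi⟩
  · rintro ⟨i, rfl⟩
    exact (e i).2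

/-- Strictly increasing finite sequences in a poset are determined by their values. -/
theorem strictMono_ext {n : ℕ} {v w : Fin n → P} (hv : StrictMono v) (hw : StrictMono w)
    (h : Set.range v = Set.range w) : v = w :=
  (StrictMono.range_inj hv hw).1 h

end FinsetChain

/-! ### The orbit functor and the chains of the fixed posets -/

namespace SimpleComplexOfFiniteGroups

open CategoryTheory OrderBar Finsupp

variable {Q : Type u} [PartialOrder Q] (𝒢 : SimpleComplexOfFiniteGroups.{u, v} Q)

theorem quotientMapOfLE_smul {J T : Q} (h : J ≤ T) (g : 𝒢.FundamentalGroup)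
    (x : 𝒢.FundamentalGroup ⧸ 𝒢.localSubgroup J) :
    Subgroup.quotientMapOfLE (𝒢.localSubgroup_mono h) (g • x) =
      g • Subgroup.quotientMapOfLE (𝒢.localSubgroup_mono h) x := by
  obtain ⟨a, rfl⟩ := QuotientGroup.mk_surjective x
  rfl

/-- The functor `J ↦ G/P_J` to the orbit category. -/
def orbitFunctor : Q ⥤ OrbitCat 𝒢.FundamentalGroup where
  obj J := ⟨𝒢.localSubgroup J, inferInstanceAs (Finite (Set.range (𝒢.ι J)))⟩
  map {J T} f :=
    ({ toFun := Subgroup.quotientMapOfLE (𝒢.localSubgroup_mono (leOfHom f))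
       map_smul' := fun g x => 𝒢.quotientMapOfLE_smul (leOfHom f) g x } :
      (𝒢.FundamentalGroup ⧸ 𝒢.localSubgroup J) →[𝒢.FundamentalGroup]
        (𝒢.FundamentalGroup ⧸ 𝒢.localSubgroup T))
  map_id J := MulActionHom.ext fun x => by
    obtain ⟨a, rfl⟩ := QuotientGroup.mk_surjective x
    rfl
  map_comp f g := MulActionHom.ext fun x => by
    obtain ⟨a, rfl⟩ := QuotientGroup.mk_surjective x
    rfl

variable {𝒢} {X : OrbitCat 𝒢.FundamentalGroup}

/-- The coset which is the value of a basis element at the base point. -/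
def basisCoset {n : ℕ} (b : Basis 𝒢.orbitFunctor n X) :
    𝒢.FundamentalGroup ⧸ 𝒢.localSubgroup (init b.simplex) :=
  (show (𝒢.FundamentalGroup ⧸ X.subgroup) →[𝒢.FundamentalGroup]
    (𝒢.FundamentalGroup ⧸ 𝒢.localSubgroup (init b.simplex)) from b.hom) (QuotientGroup.mk 1)

/-- The vertices of the simplex of the development given by a basis element. -/
def basisVertex {n : ℕ} (b : Basis 𝒢.orbitFunctor n X) (i : Fin (n + 1)) : 𝒢.DevelopmentPoset :=
  ⟨b.simplex.1 i, Subgroup.quotientMapOfLE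
    (𝒢.localSubgroup_mono (b.simplex.2.1.monotone (Fin.zero_le i))) (basisCoset b)⟩

variable (X) in
/-- The part of the development poset fixed by a finite subgroup. -/
def fixedPoset : Set 𝒢.DevelopmentPoset := {x | ∀ h ∈ X.subgroup, h • x = x}

theorem smul_basisCoset {n : ℕ} (b : Basis 𝒢.orbitFunctor n X) {h : 𝒢.FundamentalGroup}
    (hh : h ∈ X.subgroup) : h • basisCoset b = basisCoset b := by
  have h1 : h • (QuotientGroup.mk 1 : 𝒢.FundamentalGroup ⧸ X.subgroup) = QuotientGroup.mk 1 :=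
    QuotientGroup.eq.2 (by simpa using hh)
  exact (MulActionHom.map_smul _ h (QuotientGroup.mk 1)).symm.trans (congrArg _ h1)

theorem basisVertex_mem {n : ℕ} (b : Basis 𝒢.orbitFunctor n X) (i : Fin (n + 1)) :
    basisVertex b i ∈ fixedPoset X := by
  intro h hh
  exact congrArg (DevelopmentPoset.mk _)
    ((quotientMapOfLE_smul 𝒢 (b.simplex.2.1.monotone (Fin.zero_le i)) h (basisCoset b)).symm.trans
      (congrArg _ (smul_basisCoset b hh)))

theorem strictMono_basisVertex {n : ℕ} (b : Basis 𝒢.orbitFunctor n X) :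
    StrictMono (basisVertex b) := by
  intro i j hij
  obtain ⟨g, hg⟩ := QuotientGroup.mk_surjective (basisCoset b)
  unfold basisVertex
  rw [← hg]
  exact (DevelopmentPoset.mk_lt_mk_iff 𝒢 g g).2 ⟨b.simplex.2.1 hij, rfl⟩

theorem basisVertex_face {n : ℕ} (b : Basis 𝒢.orbitFunctor (n + 1) X) (i : Fin (n + 2)) :
    basisVertex (b.face i) = basisVertex b ∘ i.succAbove := by
  funext j
  obtain ⟨g, hg⟩ := QuotientGroup.mk_surjective (basisCoset b)
  have h1 : basisCoset (b.face i) = Subgroup.quotientMapOfLE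
      (𝒢.localSubgroup_mono (le_face b.simplex i)) (basisCoset b) := rfl
  unfold basisVertex
  rw [h1, Function.comp_apply, ← hg]
  rfl

/-- The indices recover the simplex, and the least vertex recovers the value of the `G`-map at the
base point, which determines the map. -/
theorem basisVertex_injective (n : ℕ) :
    Function.Injective (basisVertex (𝒢 := 𝒢) (X := X) (n := n)) := by
  intro b c h
  have h1 : b.simplex = c.simplex :=
    Subtype.ext (funext fun i => congrArg DevelopmentPoset.index (congrFun h i))
  obtain ⟨σ, α⟩ := b
  obtain ⟨σ', β⟩ := c
  obtain rfl : σ = σ' := h1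
  have h2 := congrFun h 0
  simp only [basisVertex, DevelopmentPoset.mk.injEq, heq_eq_eq, true_and] at h2
  have h3 : ∀ x : 𝒢.FundamentalGroup ⧸ 𝒢.localSubgroup (init σ),
      Subgroup.quotientMapOfLE (𝒢.localSubgroup_mono (le_refl (init σ))) x = x := by
    intro x
    obtain ⟨g, rfl⟩ := QuotientGroup.mk_surjective x
    rfl
  have h4 := (h3 _).symm.trans (h2.trans (h3 _))
  refine congrArg (Basis.mk σ) (MulActionHom.ext fun x => ?_)
  obtain ⟨g, rfl⟩ := QuotientGroup.mk_surjective x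
  have h5 : (QuotientGroup.mk g : 𝒢.FundamentalGroup ⧸ X.subgroup) = g • QuotientGroup.mk 1 :=
    congrArg QuotientGroup.mk (mul_one g).symm
  rw [h5]
  exact (MulActionHom.map_smul _ g _).trans ((congrArg (g • ·) h4).trans
    (MulActionHom.map_smul _ g _).symm)

theorem index_lt_of_lt {x y : 𝒢.DevelopmentPoset} (h : x < y) : x.index < y.index := by
  obtain ⟨J, a⟩ := x
  obtain ⟨T, b⟩ := y
  obtain ⟨g, rfl⟩ := QuotientGroup.mk_surjective a
  obtain ⟨g', rfl⟩ := QuotientGroup.mk_surjective b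
  exact ((DevelopmentPoset.mk_lt_mk_iff 𝒢 g g').1 h).1

/-- The equivariant map from `G/H` with a given value at the base point. -/
def cosetMap {H K : Subgroup 𝒢.FundamentalGroup} (c : 𝒢.FundamentalGroup ⧸ K)
    (hc : ∀ h ∈ H, h • c = c) :
    (𝒢.FundamentalGroup ⧸ H) →[𝒢.FundamentalGroup] (𝒢.FundamentalGroup ⧸ K) where
  toFun := Quotient.lift (s := QuotientGroup.leftRel H) (fun g => g • c) fun a b hab => by
    have h := congrArg (a • ·) (hc _ (QuotientGroup.leftRel_apply.1 hab))
    simpa only [smul_smul, mul_inv_cancel_left] using h.symm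
  map_smul' g x := by
    obtain ⟨a, rfl⟩ := QuotientGroup.mk_surjective x
    exact mul_smul g a c

/-- In a chain of the development all cosets are images of the least one, and that one is fixed by
the subgroup, hence the value of a `G`-map at the base point. -/
theorem exists_basis {n : ℕ} {v : Fin (n + 1) → 𝒢.DevelopmentPoset} (hv : StrictMono v)
    (hvX : ∀ i, v i ∈ fixedPoset X) : ∃ b : Basis 𝒢.orbitFunctor n X, basisVertex b = v := by
  let σ : Simplex Q n := ⟨fun i => (v i).index, fun i j hij => index_lt_of_lt (hv hij),
    fun _ => trivial⟩
  have hc : ∀ h ∈ X.subgroup, h • (v 0).coset = (v 0).coset := by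
    intro h hh
    have h1 := hvX 0 h hh
    generalize v 0 = x at h1
    obtain ⟨J, a⟩ := x
    have h2 : (⟨J, h • a⟩ : 𝒢.DevelopmentPoset) = ⟨J, a⟩ := h1
    simpa using h2
  refine ⟨⟨σ, cosetMap (v 0).coset hc⟩, funext fun i => ?_⟩
  obtain ⟨_, g, hg, hg'⟩ := hv.monotone (Fin.zero_le i)
  have h1 : basisCoset (𝒢 := 𝒢) (X := X) ⟨σ, cosetMap (v 0).coset hc⟩ = QuotientGroup.mk g :=
    (one_smul _ (v 0).coset).trans hg
  unfold basisVertex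
  rw [h1]
  exact congrArg (DevelopmentPoset.mk _) hg'.symm

end SimpleComplexOfFiniteGroups

namespace SimpleComplexOfFiniteGroups

open CategoryTheory OrderBar Finsupp OrderRealization

variable {Q : Type u} [PartialOrder Q] {𝒢 : SimpleComplexOfFiniteGroups.{u, v} Q}

/-! ### The fixed point sets of the development -/

section FixedPoints

/-- The action preserves the index, while the order strictly increases it. Hence an element that
preserves a simplex fixes it pointwise, and fixed point sets are subcomplexes. -/
theorem smul_eq_of_le {x : 𝒢.DevelopmentPoset} {h : 𝒢.FundamentalGroup}
    (hx : h • x ≤ x ∨ x ≤ h • x) : h • x = x := by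
  by_contra hne
  rcases hx with hx | hx
  · exact (index_lt_of_lt (lt_of_le_of_ne hx hne)).ne rfl
  · exact (index_lt_of_lt (lt_of_le_of_ne hx (Ne.symm hne))).ne rfl

theorem mem_fixedPoints_iff {X : OrbitCat 𝒢.FundamentalGroup} (x : 𝒢.Development) :
    x ∈ MulAction.fixedPoints X.subgroup 𝒢.Development ↔
      (x.weight.support : Set 𝒢.DevelopmentPoset) ⊆ fixedPoset X := by
  have hw : ∀ (h : 𝒢.FundamentalGroup) (p : 𝒢.DevelopmentPoset),
      (h • x).weight p = x.weight (h⁻¹ • p) := fun _ _ => rfl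
  constructor
  · intro hx p hp h hh
    have h1 : h • x = x := hx ⟨h, hh⟩
    have h2 : x.weight (h • p) = x.weight p := by
      rw [← h1, hw, inv_smul_smul, h1]
    have h3 : h • p ∈ (x.weight.support : Set 𝒢.DevelopmentPoset) := by
      rw [Finset.mem_coe, mem_support_iff] at hp ⊢
      rwa [h2]
    by_contra hne
    exact hne (smul_eq_of_le (x.isChain h3 hp hne))
  · rintro hx ⟨h, hh⟩
    refine OrderRealization.ext (Finsupp.ext fun p => ?_)
    refine (hw h p).trans ?_
    by_cases hp : x.weight p = 0
    · rw [hp]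
      by_contra hp'
      have h1 := hx (Finset.mem_coe.2 (mem_support_iff.2 hp')) h hh
      rw [smul_inv_smul] at h1
      rw [← h1] at hp'
      exact hp' hp
    · have h1 := hx (Finset.mem_coe.2 (mem_support_iff.2 hp)) h⁻¹ (inv_mem hh)
      rw [h1]

variable (X : OrbitCat 𝒢.FundamentalGroup)

/-- Acyclicity of the simplicial chains of a contractible fixed point set. -/
theorem exists_bdry_eq_of_fixedPoints
    [ContractibleSpace (MulAction.fixedPoints X.subgroup 𝒢.Development)]
    (z : Finset 𝒢.DevelopmentPoset →₀ ℤ) (hz : z ∈ supported ℤ ℤ (chainsIn (fixedPoset X)))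
    (hz0 : FinsetChain.bdry z = 0) :
    ∃ w ∈ supported ℤ ℤ (chainsIn (fixedPoset X)), FinsetChain.bdry w = z := by
  have h : (MulAction.fixedPoints X.subgroup 𝒢.Development : Set 𝒢.Development) =
      {x | (x.weight.support : Set 𝒢.DevelopmentPoset) ⊆ fixedPoset X} :=
    Set.ext mem_fixedPoints_iff
  have : ContractibleSpace {x : 𝒢.Development |
      (x.weight.support : Set 𝒢.DevelopmentPoset) ⊆ fixedPoset X} :=
    h ▸ inferInstanceAs (ContractibleSpace (MulAction.fixedPoints X.subgroup 𝒢.Development))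
  exact exists_bdry_eq_of_contractible _ z hz hz0

end FixedPoints

/-! ### The bar complex and the chains of the development -/

section Chains

variable {X : OrbitCat 𝒢.FundamentalGroup}

open scoped Classical in
/-- The set of vertices of the simplex given by a basis element. -/
noncomputable def basisFinset {n : ℕ} (b : Basis 𝒢.orbitFunctor n X) :
    Finset 𝒢.DevelopmentPoset :=
  Finset.univ.image (basisVertex b)

theorem basisFinset_injective (n : ℕ) :
    Function.Injective (basisFinset (𝒢 := 𝒢) (X := X) (n := n)) := by
  classical
  intro b c h
  refine basisVertex_injective n (FinsetChain.strictMono_ext (strictMono_basisVertex b)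
    (strictMono_basisVertex c) ?_)
  have h1 := congrArg ((↑) : Finset 𝒢.DevelopmentPoset → Set 𝒢.DevelopmentPoset) h
  simpa [basisFinset] using h1

theorem card_basisFinset {n : ℕ} (b : Basis 𝒢.orbitFunctor n X) :
    (basisFinset b).card = n + 1 := by
  classical
  rw [basisFinset, Finset.card_image_of_injective _ (strictMono_basisVertex b).injective,
    Finset.card_univ, Fintype.card_fin]

theorem basisFinset_mem {n : ℕ} (b : Basis 𝒢.orbitFunctor n X) :
    basisFinset b ∈ chainsIn (fixedPoset X) := by
  classical
  refine ⟨?_, fun x hx => ?_⟩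
  · intro x hx y hy _
    simp only [basisFinset, Finset.coe_image, Finset.coe_univ, Set.image_univ] at hx hy
    obtain ⟨i, rfl⟩ := hx
    obtain ⟨j, rfl⟩ := hy
    exact (le_total i j).imp (fun h => (strictMono_basisVertex b).monotone h)
      fun h => (strictMono_basisVertex b).monotone h
  · simp only [basisFinset, Finset.coe_image, Finset.coe_univ, Set.image_univ] at hx
    obtain ⟨i, rfl⟩ := hx
    exact basisVertex_mem b i

theorem exists_basisFinset_eq {n : ℕ} {s : Finset 𝒢.DevelopmentPoset}
    (hs : s ∈ chainsIn (fixedPoset X)) (hn : s.card = n + 1) :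
    ∃ b : Basis 𝒢.orbitFunctor n X, basisFinset b = s := by
  classical
  obtain ⟨v, hv, hvs⟩ := FinsetChain.exists_strictMono hs.1 hn
  obtain ⟨b, hb⟩ := exists_basis (X := X) hv fun i => hs.2 ((hvs _).2 ⟨i, rfl⟩)
  refine ⟨b, Finset.ext fun p => ?_⟩
  rw [hvs, basisFinset, hb]
  simp

/-- The chains of the development given by the elements of the bar complex. -/
noncomputable def toChain (n : ℕ) :
    (Basis 𝒢.orbitFunctor n X →₀ ℤ) →ₗ[ℤ] (Finset 𝒢.DevelopmentPoset →₀ ℤ) :=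
  lmapDomain ℤ ℤ basisFinset

theorem toChain_single {n : ℕ} (b : Basis 𝒢.orbitFunctor n X) :
    toChain n (single b 1) = single (basisFinset b) 1 := mapDomain_single

theorem toChain_injective (n : ℕ) :
    Function.Injective (toChain (𝒢 := 𝒢) (X := X) n) :=
  mapDomain_injective (basisFinset_injective n)

theorem toChain_mem {n : ℕ} (x : Basis 𝒢.orbitFunctor n X →₀ ℤ) :
    toChain n x ∈ supported ℤ ℤ (chainsIn (fixedPoset X)) := by
  induction x using Finsupp.induction_linear with
  | zero => rw [map_zero]; exact zero_mem _
  | add x y hx hy => rw [map_add]; exact add_mem hx hy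
  | single b c =>
    have : toChain n (single b c) = single (basisFinset b) c := mapDomain_single
    rw [this]
    exact single_mem_supported ℤ c (basisFinset_mem b)

theorem filter_toChain {n : ℕ} (x : Basis 𝒢.orbitFunctor n X →₀ ℤ) :
    (toChain n x).filter (fun s => s.card = n + 1) = toChain n x := by
  induction x using Finsupp.induction_linear with
  | zero => rw [map_zero, filter_zero]
  | add x y hx hy => rw [map_add, filter_add, hx, hy]
  | single b c =>
    have : toChain n (single b c) = single (basisFinset b) c := mapDomain_single
    rw [this]
    exact filter_single_of_pos _ (card_basisFinset b)

theorem exists_toChain_eq {n : ℕ} {w : Finset 𝒢.DevelopmentPoset →₀ ℤ}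
    (hw : w ∈ supported ℤ ℤ (chainsIn (fixedPoset X))) :
    ∃ x : Basis 𝒢.orbitFunctor n X →₀ ℤ, toChain n x = w.filter fun s => s.card = n + 1 := by
  classical
  have h : w.filter (fun s => s.card = n + 1) ∈
      supported ℤ ℤ (Set.range (basisFinset (𝒢 := 𝒢) (X := X) (n := n))) := by
    rw [mem_supported]
    intro s hs
    rw [Finset.mem_coe, support_filter, Finset.mem_filter] at hs
    exact exists_basisFinset_eq ((mem_supported ℤ w).1 hw hs.1) hs.2
  rw [← Set.image_univ, ← lmapDomain_supported] at h
  obtain ⟨x, _, hx⟩ := h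
  exact ⟨x, hx⟩

theorem bdry_toChain {n : ℕ} (x : Basis 𝒢.orbitFunctor (n + 1) X →₀ ℤ) :
    FinsetChain.bdry (toChain (n + 1) x) = toChain n (OrderBar.bdry n X x) := by
  classical
  have : FinsetChain.bdry ∘ₗ toChain (𝒢 := 𝒢) (X := X) (n + 1) =
      toChain n ∘ₗ OrderBar.bdry n X := by
    refine lhom_ext' fun b => LinearMap.ext_ring ?_
    simp only [LinearMap.comp_apply, lsingle_apply, toChain_single, OrderBar.bdry_single, map_sum,
      map_smul]
    refine (FinsetChain.bdry_image (strictMono_basisVertex b)).trans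
      (Finset.sum_congr rfl fun i _ => ?_)
    rw [basisFinset, basisVertex_face]
  exact LinearMap.congr_fun this x

/-- The sum of the coefficients. -/
noncomputable def coeffSum : (Basis 𝒢.orbitFunctor 0 X →₀ ℤ) →ₗ[ℤ] ℤ :=
  linearCombination ℤ fun _ => 1

theorem coeffSum_comp_bdry :
    coeffSum ∘ₗ OrderBar.bdry 0 X = (0 : (Basis 𝒢.orbitFunctor 1 X →₀ ℤ) →ₗ[ℤ] ℤ) := by
  refine lhom_ext' fun b => LinearMap.ext_ring ?_
  simp only [LinearMap.comp_apply, lsingle_apply, OrderBar.bdry_single, coeffSum]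
  simp

theorem bdry_toChain_zero (x : Basis 𝒢.orbitFunctor 0 X →₀ ℤ) :
    FinsetChain.bdry (toChain 0 x) = single ∅ (coeffSum x) := by
  classical
  have : FinsetChain.bdry ∘ₗ toChain (𝒢 := 𝒢) (X := X) 0 = lsingle ∅ ∘ₗ coeffSum := by
    refine lhom_ext' fun b => LinearMap.ext_ring ?_
    simp only [LinearMap.comp_apply, lsingle_apply, toChain_single, coeffSum,
      linearCombination_single, one_smul]
    refine (FinsetChain.bdry_image (strictMono_basisVertex b)).trans ?_
    rw [Fin.sum_univ_one]
    simp
  exact LinearMap.congr_fun this x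

variable [ContractibleSpace (MulAction.fixedPoints X.subgroup 𝒢.Development)]

theorem exists_bdry_eq {n : ℕ} (x : Basis 𝒢.orbitFunctor n X →₀ ℤ)
    (hx : FinsetChain.bdry (toChain n x) = 0) : ∃ y, OrderBar.bdry n X y = x := by
  obtain ⟨w, hw, hwx⟩ := exists_bdry_eq_of_fixedPoints X _ (toChain_mem x) hx
  obtain ⟨y, hy⟩ := exists_toChain_eq (n := n + 1) hw
  refine ⟨y, toChain_injective n ?_⟩
  -- The filling `w` need not be homogeneous; its part of the right degree has the same boundary.
  rw [← bdry_toChain, hy, ← FinsetChain.filter_bdry, hwx, filter_toChain]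

/-- A multiple of the empty simplex is a cycle of the augmented complex, and the vertices in a
filling of it have total coefficient `c`. -/
theorem exists_coeffSum_eq (c : ℤ) :
    ∃ x : Basis 𝒢.orbitFunctor 0 X →₀ ℤ, coeffSum x = c := by
  obtain ⟨w, hw, hwx⟩ := exists_bdry_eq_of_fixedPoints X (single ∅ c)
    (single_mem_supported ℤ c ⟨by simp, by simp⟩) (by
      have : single (∅ : Finset 𝒢.DevelopmentPoset) c = c • single ∅ 1 := by simp
      rw [this, map_smul, FinsetChain.bdry_single, Finset.sum_empty, smul_zero])
  obtain ⟨y, hy⟩ := exists_toChain_eq (n := 0) hw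
  refine ⟨y, single_injective (∅ : Finset 𝒢.DevelopmentPoset) ?_⟩
  rw [← bdry_toChain_zero, hy]
  refine (FinsetChain.filter_bdry 0 w).symm.trans ?_
  rw [hwx]
  exact filter_single_of_pos _ rfl

end Chains

/-! ### The resolution of the trivial module -/

/-- The augmentation of the bar complex. -/
noncomputable def augmentation (𝒢 : SimpleComplexOfFiniteGroups.{u, v} Q) :
    obj 𝒢.orbitFunctor 0 ⟶ trivialOrbitModule 𝒢.FundamentalGroup :=
  ofValues fun _ => (ULift.up 1 : ULift.{max u v} ℤ)

theorem component_augmentation (X : OrbitCat 𝒢.FundamentalGroup)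
    (x : Basis 𝒢.orbitFunctor 0 X →₀ ℤ) :
    component 𝒢.augmentation X x = (ULift.up (coeffSum x) : ULift.{max u v} ℤ) := by
  let L : ULift.{max u v} ℤ →+ ℤ := AddEquiv.ulift.toAddMonoidHom
  have h : ∀ x, L (component 𝒢.augmentation X x) = coeffSum x := by
    intro x
    have : L.comp (component 𝒢.augmentation X) = (coeffSum (𝒢 := 𝒢) (X := X)).toAddMonoidHom := by
      refine addHom_ext' fun b => AddMonoidHom.ext_int ?_
      refine (congrArg L (component_single 𝒢.augmentation b)).trans ?_
      refine Eq.trans ?_ (linearCombination_single_one (R := ℤ) ..).symm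
      have h1 : OrderBar.eval 𝒢.augmentation b.simplex = (ULift.up 1 : ULift.{max u v} ℤ) :=
        eval_ofValues (M := trivialOrbitModule 𝒢.FundamentalGroup) _ b.simplex
      exact congrArg (fun y => L (((trivialOrbitModule 𝒢.FundamentalGroup).map b.hom.op).hom y)) h1
    exact DFunLike.congr_fun this x
  exact ULift.ext _ _ (h x)

theorem isProjectiveResolution_augmentation
    (hcontr : ∀ H : Subgroup 𝒢.FundamentalGroup, Finite H →
      ContractibleSpace (MulAction.fixedPoints H 𝒢.Development)) :
    IsProjectiveResolution (complex 𝒢.orbitFunctor) 𝒢.augmentation := by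
  have hX : ∀ X : OrbitCat 𝒢.FundamentalGroup,
      ContractibleSpace (MulAction.fixedPoints X.subgroup 𝒢.Development) :=
    fun X => hcontr X.subgroup X.finite
  refine isProjectiveResolution _ (fun X c => ?_) (fun X x => ?_) (fun X x hx => ?_)
    fun n X x hx => exists_bdry_eq x ?_
  · obtain ⟨x, hx⟩ := exists_coeffSum_eq (𝒢 := 𝒢) (X := X) (ULift.down (α := ℤ) c)
    exact ⟨x, (component_augmentation X x).trans (congrArg ULift.up hx)⟩
  · refine (component_augmentation X _).trans (congrArg ULift.up ?_)
    exact LinearMap.congr_fun coeffSum_comp_bdry x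
  · refine exists_bdry_eq x ?_
    have h1 := congrArg (ULift.down (α := ℤ)) ((component_augmentation X x).symm.trans hx)
    refine (bdry_toChain_zero x).trans ((congrArg (single ∅) ?_).trans (single_zero _))
    exact h1
  · rw [bdry_toChain, hx, map_zero]

end SimpleComplexOfFiniteGroups

/-! ### Orders of the local groups and the lower bound -/

namespace SimpleComplexOfFiniteGroups

open CategoryTheory OrderBar Opposite

variable {Q : Type u} [PartialOrder Q] {𝒢 : SimpleComplexOfFiniteGroups.{u, v} Q}

/-- Equality of the two subgroups of `G` would make `P_U → P_V` surjective, because `P_V` embeds in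
`G`. -/
theorem card_localSubgroup_lt (hdev : 𝒢.StrictlyDevelopable) {U V : Q} (h : U < V) :
    Nat.card (𝒢.localSubgroup U) < Nat.card (𝒢.localSubgroup V) := by
  have : Finite (𝒢.localSubgroup V) := inferInstanceAs (Finite (Set.range (𝒢.ι V)))
  by_contra hle
  have heq := Subgroup.eq_of_le_of_card_ge (𝒢.localSubgroup_mono h.le) (not_lt.1 hle)
  refine 𝒢.not_surjective h fun y => ?_
  have hy : 𝒢.ι V y ∈ 𝒢.localSubgroup U := heq ▸ ⟨y, rfl⟩
  obtain ⟨x, hx⟩ := hy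
  exact ⟨x, hdev V ((𝒢.ι_φ h x).trans hx)⟩

theorem eq_of_le_of_card_eq (hdev : 𝒢.StrictlyDevelopable) {U V : Q} (h : U ≤ V)
    (hc : Nat.card (𝒢.localSubgroup U) = Nat.card (𝒢.localSubgroup V)) : U = V :=
  h.eq_of_not_lt fun hlt => (card_localSubgroup_lt hdev hlt).ne hc

theorem card_of_mem_sameLocalGroup {J U : Q} (h : U ∈ 𝒢.sameLocalGroup J) :
    Nat.card (𝒢.localSubgroup U) = Nat.card (𝒢.localSubgroup J) := by
  rw [show 𝒢.localSubgroup U = 𝒢.localSubgroup J from h]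

theorem isAntichain_sameLocalGroup (hdev : 𝒢.StrictlyDevelopable) (J : Q) :
    IsAntichain (· ≤ ·) (𝒢.sameLocalGroup J) := fun _ hU _ hV hne hle =>
  hne (eq_of_le_of_card_eq hdev hle
    ((card_of_mem_sameLocalGroup hU).trans (card_of_mem_sameLocalGroup hV).symm))

section LowerBound

variable (𝒢) in
/-- The coefficients concentrated on the subgroups of the order of the local group at `J`. -/
noncomputable abbrev localModule (J : Q) : OrbitModule 𝒢.FundamentalGroup :=
  orderModule 𝒢.FundamentalGroup (Nat.card (𝒢.localSubgroup J))

/-- The value of an element of the coefficient module at a vertex of the correct order. -/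
noncomputable def valueAt {J V : Q}
    (hV : Nat.card (𝒢.localSubgroup V) = Nat.card (𝒢.localSubgroup J)) :
    (𝒢.localModule J).obj (op (𝒢.orbitFunctor.obj V)) →+ ℤ where
  toFun x := (show ULift (PLift (Nat.card (𝒢.localSubgroup V) =
    Nat.card (𝒢.localSubgroup J))) → ℤ from x) ⟨⟨hV⟩⟩
  map_zero' := rfl
  map_add' _ _ := rfl

theorem localModule_ext {J V : Q} {x y : (𝒢.localModule J).obj (op (𝒢.orbitFunctor.obj V))}
    (h : ∀ hV, valueAt hV x = valueAt hV y) : x = y :=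
  funext fun hV => h hV.down.down

open scoped Classical in
theorem valueAt_res {J U V : Q} (h : U ≤ V)
    (hU : Nat.card (𝒢.localSubgroup U) = Nat.card (𝒢.localSubgroup J))
    (x : (𝒢.localModule J).obj (op (𝒢.orbitFunctor.obj V))) :
    valueAt hU (res h x) =
      if hV : Nat.card (𝒢.localSubgroup V) = Nat.card (𝒢.localSubgroup J) then valueAt hV x
      else 0 := rfl

/-- The element of the coefficient module with a given value. -/
noncomputable def constValue (J V : Q) (c : ℤ) :
    (𝒢.localModule J).obj (op (𝒢.orbitFunctor.obj V)) :=
  show ULift (PLift (Nat.card (𝒢.localSubgroup V) = Nat.card (𝒢.localSubgroup J))) → ℤ from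
    fun _ => c

theorem valueAt_constValue {J V : Q}
    (hV : Nat.card (𝒢.localSubgroup V) = Nat.card (𝒢.localSubgroup J)) (c : ℤ) :
    valueAt (𝒢 := 𝒢) hV (constValue J V c) = c := rfl

/-- A restriction map between vertices of order `|P_J|` occurs only at equal vertices, so the
coboundary with these coefficients keeps just the faces with the same initial vertex, as the
relative coboundary does. -/
theorem not_nontrivial_relCohomology_of_cocyclesBound (hdev : 𝒢.StrictlyDevelopable) (J : Q)
    (n : ℕ) (h : CocyclesBound (complex 𝒢.orbitFunctor) n (𝒢.localModule J)) :
    ¬ Nontrivial (relCohomology (upperSubposet (𝒢.sameLocalGroup J))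
      (strictUpperSubposet (𝒢.sameLocalGroup J)) (n + 1)) := by
  classical
  have hΩ := isAntichain_sameLocalGroup hdev J
  rw [not_nontrivial_relCohomology_succ_iff]
  intro f hf hf0
  -- Extension by zero also to simplices whose initial local group has the right order but is a
  -- different subgroup.
  let t : Simplex Q (n + 1) → ℤ := fun τ =>
    if h : init τ ∈ 𝒢.sameLocalGroup J then f (ofSimplex τ h) else 0
  obtain ⟨g, hg⟩ := (cocyclesBound_iff n).1 h (fun τ => constValue J (init τ) (t τ)) fun σ => by
    refine localModule_ext fun hV => ?_
    rw [map_sum, map_zero]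
    have hres : ∀ i : Fin (n + 3), valueAt hV ((-1 : ℤ) ^ (i : ℕ) • res (le_face σ i)
        (constValue J (init (σ.face i)) (t (σ.face i)))) = (-1 : ℤ) ^ (i : ℕ) * t (σ.face i) := by
      intro i
      rw [map_zsmul, valueAt_res, smul_eq_mul]
      congr 1
      by_cases hc : Nat.card (𝒢.localSubgroup (init (σ.face i))) = Nat.card (𝒢.localSubgroup J)
      · rw [dif_pos hc, valueAt_constValue]
      · rw [dif_neg hc]
        exact (show t (σ.face i) = 0 from
          dif_neg fun hm => hc (card_of_mem_sameLocalGroup hm)).symm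
    rw [Finset.sum_congr rfl fun i _ => hres i]
    by_cases hσ : init σ ∈ 𝒢.sameLocalGroup J
    · refine Eq.trans (Finset.sum_congr rfl fun i _ => ?_) (congrFun hf0 (ofSimplex σ hσ))
      congr 1
      by_cases hi : init (σ.face i) ∈ 𝒢.sameLocalGroup J
      · exact dif_pos hi
      · refine (dif_neg hi).trans (relCochain_eq_zero hf ((ofSimplex σ hσ).face i) hσ ?_).symm
        refine lt_of_le_of_ne (le_face σ i) fun he => hi ?_
        exact (show init σ = init (σ.face i) from he) ▸ hσ
    · refine Finset.sum_eq_zero fun i _ => ?_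
      rw [show t (σ.face i) = 0 from dif_neg fun hi => hσ ?_, mul_zero]
      rw [eq_of_le_of_card_eq hdev (le_face σ i) (hV.trans (card_of_mem_sameLocalGroup hi).symm)]
      exact hi
  let ψ : OrderSimplex (upperSubposet (𝒢.sameLocalGroup J)) n → ℤ := fun τ =>
    if h : init (toSimplex τ) ∈ 𝒢.sameLocalGroup J then
      valueAt (card_of_mem_sameLocalGroup h) (g (toSimplex τ)) else 0
  have hψ : ψ ∈ relCochains (upperSubposet (𝒢.sameLocalGroup J))
      (strictUpperSubposet (𝒢.sameLocalGroup J)) n := fun τ hτ =>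
    dif_neg fun h => notMem_strictUpperSubposet hΩ h (hτ 0)
  refine ⟨ψ, hψ, funext fun σ => ?_⟩
  by_cases hσ : init (toSimplex σ) ∈ 𝒢.sameLocalGroup J
  · have hc := card_of_mem_sameLocalGroup hσ
    have h1 := congrArg (valueAt hc) (hg (toSimplex σ))
    rw [map_sum, valueAt_constValue] at h1
    change ∑ i : Fin (n + 2), (-1 : ℤ) ^ (i : ℕ) * ψ (σ.face i) = f σ
    refine Eq.trans (Finset.sum_congr rfl fun i _ => ?_) (h1.trans (dif_pos hσ))
    rw [map_zsmul, valueAt_res, smul_eq_mul]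
    congr 1
    split_ifs with hi
    · have h2 := eq_of_le_of_card_eq hdev (le_face (toSimplex σ) i) (hc.trans hi.symm)
      exact dif_pos (show init (toSimplex (σ.face i)) ∈ 𝒢.sameLocalGroup J from h2 ▸ hσ)
    · exact dif_neg fun hm => hi (card_of_mem_sameLocalGroup hm)
  -- Such a simplex lies in the smaller subcomplex, where both relative cochains vanish.
  · have h0 : ∀ i, σ.1 i ∈ strictUpperSubposet (𝒢.sameLocalGroup J) := by
      obtain ⟨W, hW, hlt⟩ := mem_strictUpperSubposet_of_notMem (σ.2.2 0) hσ
      exact fun i => ⟨W, hW, hlt.trans_le (σ.2.1.monotone (Fin.zero_le i))⟩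
    exact (simplicialCoboundary_mem _ _ n ψ hψ σ h0).trans (hf σ h0).symm

end LowerBound

end SimpleComplexOfFiniteGroups

/-! ### The Bredon dimension as the top relative degree -/

open CategoryTheory OrderBar SimpleComplexOfFiniteGroups in
theorem mainTheorem4 {Q : Type u} [PartialOrder Q] [Finite Q]
    (𝒢 : SimpleComplexOfFiniteGroups.{u, v} Q) (hdev : 𝒢.StrictlyDevelopable)
    (hcontr : ∀ H : Subgroup 𝒢.FundamentalGroup, Finite H →
      ContractibleSpace (MulAction.fixedPoints H 𝒢.Development)) :
    ∃ d : ℕ, bredonCd 𝒢.FundamentalGroup = d ∧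
      IsGreatest {n : ℕ | ∃ J : Q, Nontrivial (relCohomology
        (upperSubposet (𝒢.sameLocalGroup J)) (strictUpperSubposet (𝒢.sameLocalGroup J)) n)} d := by
  set S := {n : ℕ | ∃ J : Q, Nontrivial (relCohomology
    (upperSubposet (𝒢.sameLocalGroup J)) (strictUpperSubposet (𝒢.sameLocalGroup J)) n)} with hS
  have hR := isProjectiveResolution_augmentation hcontr
  -- The fixed point set of the trivial subgroup is contractible, hence nonempty, while an empty
  -- poset carries no weights of sum `1`.
  have hQ : Nonempty Q := by
    have := hcontr ⊥ inferInstance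
    obtain ⟨x, -⟩ := (inferInstance : Nonempty (MulAction.fixedPoints
      (⊥ : Subgroup 𝒢.FundamentalGroup) 𝒢.Development))
    by_contra hQ
    have : IsEmpty 𝒢.DevelopmentPoset := ⟨fun p => hQ ⟨p.index⟩⟩
    have h1 := x.sum_eq_one
    rw [Subsingleton.elim x.weight 0, Finsupp.sum_zero_index] at h1
    exact zero_ne_one h1
  have hne : S.Nonempty := by
    -- A vertex whose local group has the largest order is maximal in `Q`, so degree `0` belongs to
    -- `S`.
    obtain ⟨J, hJ⟩ := Finite.exists_max (fun J : Q => Nat.card (𝒢.localSubgroup J))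
    refine ⟨0, J, nontrivial_relCohomology_zero_of_isMax (isAntichain_sameLocalGroup hdev J)
      (U := J) rfl fun V hV => ?_⟩
    rcases hV.eq_or_lt with rfl | hV
    · exact le_rfl
    · exact absurd (hJ V) (not_le.2 (card_localSubgroup_lt hdev hV))
  have hbdd : BddAbove S := by
    refine ⟨Nat.card Q, ?_⟩
    rintro n ⟨J, hJ⟩
    by_contra hn
    obtain ⟨k, rfl⟩ : ∃ k, n = k + 1 := ⟨n - 1, by omega⟩
    exact not_nontrivial_relCohomology_of_card_le _ _ k (by omega) hJ
  obtain ⟨d, hd⟩ : ∃ d, IsGreatest S d := ⟨sSup S, Nat.sSup_mem hne hbdd, fun n hn =>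
    le_csSup hbdd hn⟩
  refine ⟨d, le_antisymm ?_ ?_, hd⟩
  · have hstar : ∀ U : Q, StarExact U d := fun U =>
      starExact_of_relCohomology (isAntichain_sameLocalGroup hdev U) rfl d fun n hn hnt =>
        absurd (hd.2 ⟨U, hnt⟩) (by omega)
    obtain ⟨L, η, hL, hL0⟩ := hR.exists_length_le d fun M => cocyclesBound_of_starExact hstar
    exact sInf_le ⟨hL.toProjectiveResolution, fun i hi => hL0 i (by exact_mod_cast hi)⟩
  · refine le_sInf ?_
    rintro k ⟨R, hk⟩
    by_contra hlt
    rw [not_le] at hlt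
    -- For `d = 0` no length lies below `d`, so only positive degrees need the cohomological
    -- argument.
    obtain ⟨n, rfl⟩ : ∃ n, d = n + 1 := ⟨d - 1, by
      have : d ≠ 0 := by rintro rfl; simp at hlt
      omega⟩
    obtain ⟨J, hJ⟩ := hd.1
    exact not_nontrivial_relCohomology_of_cocyclesBound hdev J n
      (hR.toProjectiveResolution.cocyclesBound_of_isZero R n (hk (n + 1) hlt) _) hJ
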